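/- A graph on $n$ vertices is called even-degenerate if there is an ordering $v_1,\dots,v_n$ of its vertices such that for each $1\le i\le n-2$, the vertex $v_i$ has an even number of neighbours in the set $\{v_{i+1},\dots,v_n\}$. Let $G(n,1/2)$ denote the binomial random graph on $n$ vertices in which each pair of vertices is an edge independently with probability $1/2$. If $H\sim G(n,1/2)$, then $$\mathbb{P}(H\text{ is not even-degenerate})=e^{-\Theta(n)}.$$ That is, there are absolute constants $c,C>0$ such that for every integer $n\ge 4$, $$e^{-Cn}\le \mathbb{P}(H\text{ is not even-degenerate})\le e^{-cn}.$$ Moreover, for every $n\ge 4$ this probability is at least $(1/2)^{2n-3}$. -/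

import Mathlib

/-- A finite graph `G` on `n` vertices is even-degenerate if its vertices can be ordered
`v 0, v 1, …, v (n - 1)` such that every vertex `v i` other than the last two (that is, with
`i + 2 < n`) has an even number of neighbours among the later vertices `v j`, `i < j`. -/
def SimpleGraph.IsEvenDegenerate {V : Type*} [Finite V] (G : SimpleGraph V) : Prop :=
  ∃ v : Fin (Nat.card V) ≃ V, ∀ i : Fin (Nat.card V), (i : ℕ) + 2 < Nat.card V →
    Even (G.neighborSet (v i) ∩ v '' Set.Ioi i).ncard

/-- The real number `1 / 2` as an element of the unit interval. -/
noncomputable def edgeProbHalf : unitInterval := ⟨1 / 2, by norm_num, by norm_num⟩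

/-- The probability that the binomial random graph `G(n, 1/2)` on the vertex set `Fin n` is
not even-degenerate. -/
noncomputable def probNotEvenDegenerate (n : ℕ) : ℝ :=
  (SimpleGraph.binomialRandom (Fin n) edgeProbHalf).real {H | ¬ H.IsEvenDegenerate}

open Finset

set_option linter.unusedSectionVars false

namespace ParityPeeling

/-! ### Peeling a symmetric matrix over `ZMod 2` -/

section

variable {V : Type*} [DecidableEq V]

/-! Upper bound. Keep one vertex of the graph to the end and record its adjacencies on the diagonal.
A uniform graph on `m + 1` vertices becomes a uniform symmetric matrix over `ZMod 2` on `m` indices,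
and a deletion is legal when the row sum over the current set vanishes. A graph that is not
even-degenerate gives a matrix from which legal deletions never reach a set of size at most one
(`fail_pointedMatrix`).

A polynomial bound comes from second moments. By `quad_eq` a deletion is legal iff it preserves the
quadratic form of the matrix, so one counts deletion orders along which the form is constantly `ε`.
Two orders are correlated only through the nonempty sets they share, weighted by inverse binomial
coefficients, so the normalised second moment is `2 + O(1/m)`. Cauchy–Schwarz gives each `ε`
probability near `1/2`; the events for `ε = 0, 1` are disjoint, so failure has probability `O(1/m)`
(`exists_failCount_le_div`).

To amplify, split the vertices into halves `P` and `Q`, and clear `Q` by spending vertices of `P`. A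
fresh vertex either joins the carried set or is deleted; deletion re-randomises the carried
parities, so each carried vertex can then be dropped with probability `1/2`. A potential argument
makes it exponentially unlikely in `i` that `i` fresh vertices do not suffice (`sum_not_hit_le`).
Overall failure then forces failure on a tail of `P` and, symmetrically, on a tail of `Q`, which are
independent events. So failure at size `n` costs about `√n` times a product of two failure
probabilities at size about `n / 2` (`failCount_union_le`). For a bound `D * exp (-c k) / k` the
product gains `1 / n ^ 2`, which beats `√n`, and strong induction closes
(`exists_failCount_le_exp`).

Lower bound. If all degrees are odd, no vertex can come first; an isolated extra vertex does not
help. Every graph on `n - 2` vertices extends injectively to such a graph on `n` vertices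
(`oddExtension`), and only `2 * n - 3` pairs involve the two new vertices. -/

/-- The parity of the row of `v` in the symmetric matrix `M`, restricted to the columns in `S`.
Diagonal entries of `M` play the role of parities of neighbours outside the vertex set. -/
def parDeg (M : Sym2 V → ZMod 2) (S : Finset V) (v : V) : ZMod 2 := ∑ w ∈ S, M s(v, w)

/-- `Reach M S S'`: from `S` one arrives at `S'` by successively removing vertices whose
parity with respect to the current set vanishes. -/
inductive Reach (M : Sym2 V → ZMod 2) : Finset V → Finset V → Prop
  | refl (S : Finset V) : Reach M S S
  | step {S S' : Finset V} {v : V} : v ∈ S → parDeg M S v = 0 → Reach M (S.erase v) S' →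
      Reach M S S'

/-- No set with at most one element is reachable from `S`. -/
def Fail (M : Sym2 V → ZMod 2) (S : Finset V) : Prop :=
  ∀ S' : Finset V, S'.card ≤ 1 → ¬ Reach M S S'

lemma Reach.trans {M : Sym2 V → ZMod 2} {S S' S'' : Finset V} (h : Reach M S S')
    (h' : Reach M S' S'') : Reach M S S'' := by
  induction h with
  | refl => exact h'
  | step hv hd _ ih => exact .step hv hd (ih h')

lemma Fail.of_reach {M : Sym2 V → ZMod 2} {S S' : Finset V} (hF : Fail M S)
    (h : Reach M S S') : Fail M S' :=
  fun X hX hR => hF X hX (h.trans hR)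

lemma parDeg_congr {M N : Sym2 V → ZMod 2} {S : Finset V} {v : V} (hv : v ∈ S)
    (h : ∀ x ∈ S, ∀ y ∈ S, M s(x, y) = N s(x, y)) : parDeg M S v = parDeg N S v :=
  sum_congr rfl fun w hw => h v hv w hw

lemma Reach.congr {M N : Sym2 V → ZMod 2} {S S' : Finset V} (hR : Reach M S S')
    (h : ∀ x ∈ S, ∀ y ∈ S, M s(x, y) = N s(x, y)) : Reach N S S' := by
  induction hR with
  | refl => exact .refl _
  | step hv hd _ ih =>
    refine .step hv ((parDeg_congr hv h).symm.trans hd) (ih fun x hx y hy => ?_)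
    exact h x (mem_of_mem_erase hx) y (mem_of_mem_erase hy)

lemma fail_congr {M N : Sym2 V → ZMod 2} {S : Finset V}
    (h : ∀ x ∈ S, ∀ y ∈ S, M s(x, y) = N s(x, y)) : Fail M S ↔ Fail N S :=
  ⟨fun hF X hX hR => hF X hX (hR.congr fun x hx y hy => (h x hx y hy).symm),
    fun hF X hX hR => hF X hX (hR.congr h)⟩

lemma parDeg_add (M N : Sym2 V → ZMod 2) (S : Finset V) (v : V) :
    parDeg (M + N) S v = parDeg M S v + parDeg N S v := by
  simp [parDeg, sum_add_distrib]

lemma parDeg_erase (M : Sym2 V → ZMod 2) {S : Finset V} {u : V} (hu : u ∈ S) (v : V) :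
    parDeg M (S.erase u) v = parDeg M S v + M s(u, v) := by
  unfold parDeg
  rw [← add_sum_erase S _ hu, Sym2.eq_swap (a := u), add_comm (M s(v, u)), add_assoc,
    CharTwo.add_self_eq_zero, add_zero]

lemma zmod_two_ne_zero {a : ZMod 2} : a ≠ 0 ↔ a = 1 := by
  revert a; decide

/-- One pass through a list of vertices: a vertex is dropped if its current parity vanishes,
and the parities of the later ones are updated by the matrix `K`. -/
def pass (K : V → V → ZMod 2) : (V → ZMod 2) → List V → List V
  | _, [] => []
  | d, h :: l => if d h = 0 then pass K (d + K h) l else h :: pass K d l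

lemma pass_sublist (K : V → V → ZMod 2) (d : V → ZMod 2) (l : List V) :
    (pass K d l).Sublist l := by
  induction l generalizing d with
  | nil => simp [pass]
  | cons h l ih =>
    rw [pass]
    split_ifs
    · exact (ih _).cons _
    · exact (ih _).cons_cons _

lemma pass_congr {K K' : V → V → ZMod 2} {d d' : V → ZMod 2} {l : List V}
    (hK : ∀ a ∈ l, ∀ b ∈ l, K a b = K' a b) (hd : ∀ a ∈ l, d a = d' a) :
    pass K d l = pass K' d' l := by
  induction l generalizing d d' with
  | nil => simp [pass]
  | cons h l ih =>
    rw [pass, pass, hd h (by simp)]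
    have hK' : ∀ a ∈ l, ∀ b ∈ l, K a b = K' a b := fun a ha b hb =>
      hK a (by simp [ha]) b (by simp [hb])
    rw [ih hK' (d := d + K h) (d' := d' + K' h), ih hK' (d := d) (d' := d')]
    · exact fun a ha => hd a (by simp [ha])
    · exact fun a ha => by simp [hd a (by simp [ha]), hK h (by simp) a (by simp [ha])]

/-- Deleting `h` changes the parity of `b` by `M s(h, b)`, so the update in `pass` keeps `d` equal
to the true parities. Kept vertices move into `R`. -/
lemma reach_pass (M : Sym2 V → ZMod 2) (l : List V) (R : Finset V) (d : V → ZMod 2)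
    (hl : l.Nodup) (hR : ∀ x ∈ l, x ∉ R)
    (hd : ∀ x ∈ l, d x = parDeg M (l.toFinset ∪ R) x) :
    Reach M (l.toFinset ∪ R) ((pass (fun a b => M s(a, b)) d l).toFinset ∪ R) := by
  induction l generalizing d R with
  | nil => exact .refl _
  | cons h l ih =>
    rw [List.nodup_cons] at hl
    rw [pass]
    have hhR : h ∉ R := hR h (by simp)
    have hmem : h ∈ (h :: l).toFinset ∪ R := by simp
    have her : ((h :: l).toFinset ∪ R).erase h = l.toFinset ∪ R := by
      ext x
      simp only [mem_erase, mem_union, List.mem_toFinset, List.mem_cons]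
      constructor
      · rintro ⟨h1, (h2 | h2) | h2⟩ <;> tauto
      · rintro (h2 | h2)
        · exact ⟨fun e => hl.1 (e ▸ h2), by tauto⟩
        · exact ⟨fun e => hhR (e ▸ h2), by tauto⟩
    split_ifs with h0
    · refine .step hmem (by rw [← hd h (by simp), h0]) ?_
      rw [her]
      refine ih R (d + fun b => M s(h, b)) hl.2 (fun x hx => hR x (by simp [hx])) fun x hx => ?_
      rw [← her, parDeg_erase M hmem, ← hd x (by simp [hx])]
      rfl
    · have e1 : (h :: l).toFinset ∪ R = l.toFinset ∪ insert h R := by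
        ext x; simp
      have e2 : (h :: pass (fun a b => M s(a, b)) d l).toFinset ∪ R =
          (pass (fun a b => M s(a, b)) d l).toFinset ∪ insert h R := by
        ext x; simp
      rw [e1, e2]
      refine ih (insert h R) d hl.2 (fun x hx => ?_) fun x hx => ?_
      · rw [mem_insert, not_or]
        exact ⟨fun e => hl.1 (e ▸ hx), hR x (by simp [hx])⟩
      · rw [← e1]; exact hd x (by simp [hx])

variable [Fintype V]

lemma sum_flip (h : V) (g : (V → ZMod 2) → ℝ) :
    ∑ ρ, g ρ = (∑ ρ, (g ρ + g (ρ + Pi.single h 1))) / 2 := by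
  have := Equiv.sum_comp (Equiv.addRight (Pi.single h 1 : V → ZMod 2)) g
  simp only [Equiv.coe_addRight] at this
  rw [sum_add_distrib, this]
  ring

/-- Flipping `ρ` at the head exchanges keeping and dropping it, so survivals behave like fair
independent coins: the mean is half the length, and nobody survives with probability `2 ^
(-length)`. A kept head raises `a` by one and kills the `c` term, which is why both parameters are
free. -/
lemma sum_pass (K : V → V → ZMod 2) (l : List V) (hl : l.Nodup) (d : V → ZMod 2) (a c : ℝ) :
    ∑ ρ : V → ZMod 2, (a + (pass K (d + ρ) l).length - c * 0 ^ (pass K (d + ρ) l).length) =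
      2 ^ Fintype.card V * (a + l.length / 2 - c / 2 ^ l.length) := by
  induction l generalizing d a c with
  | nil => simp [pass]; ring
  | cons h l ih =>
    rw [List.nodup_cons] at hl
    have key : ∀ ρ : V → ZMod 2, ∀ f : ℕ → ℝ,
        f (pass K (d + ρ) (h :: l)).length + f (pass K (d + (ρ + Pi.single h 1)) (h :: l)).length =
        f (pass K (d + K h + ρ) l).length + f ((pass K (d + ρ) l).length + 1) := by
      intro ρ f
      have hs : ∀ x ∈ l, (Pi.single h (1 : ZMod 2) : V → ZMod 2) x = 0 := fun x hx =>
        Pi.single_eq_of_ne (fun e => hl.1 (by rw [← e]; exact hx)) _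
      have e1 : pass K (d + (ρ + Pi.single h 1)) l = pass K (d + ρ) l :=
        pass_congr (fun _ _ _ _ => rfl) fun x hx => by simp [hs x hx]
      have e2 : pass K (d + (ρ + Pi.single h 1) + K h) l = pass K (d + K h + ρ) l :=
        pass_congr (fun _ _ _ _ => rfl) fun x hx => by
          simp only [Pi.add_apply, hs x hx]; ring
      have e3 : d + ρ + K h = d + K h + ρ := by abel
      rw [pass, pass, e1, e2, e3]
      by_cases h0 : (d + ρ) h = 0
      · have h1 : (d + (ρ + Pi.single h 1) : V → ZMod 2) h ≠ 0 := by
          rw [← add_assoc, Pi.add_apply, h0]; simp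
        rw [if_pos h0, if_neg h1]; rfl
      · have h1 : (d + (ρ + Pi.single h 1) : V → ZMod 2) h = 0 := by
          rw [← add_assoc, Pi.add_apply, zmod_two_ne_zero.1 h0, Pi.single_eq_same]; rfl
        rw [if_neg h0, if_pos h1, add_comm]; rfl
    rw [sum_flip h]
    have := fun ρ => key ρ (fun n => a + (n : ℝ) - c * 0 ^ n)
    simp only [this, sum_add_distrib]
    rw [ih hl.2 (d + K h) a c]
    have h2 := ih hl.2 d (a + 1) 0
    simp only [zero_mul, sub_zero, zero_div] at h2
    have h3 : ∀ ρ : V → ZMod 2, a + (((pass K (d + ρ) l).length + 1 : ℕ) : ℝ) -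
        c * 0 ^ ((pass K (d + ρ) l).length + 1) = a + 1 + (pass K (d + ρ) l).length := by
      intro ρ; push_cast; ring
    simp only [h3, h2, List.length_cons]
    push_cast
    ring

end

/-! ### Clearing a carried set by means of fresh vertices -/

section

variable {V : Type*} [DecidableEq V]

/-- The translation adding `ρ h` to the entries `(p, h)` and `(b, h)` for `h ∈ C`, and `ρ p` to the
diagonal entry at `p`. -/
def rowShift (p b : V) (C : Finset V) (ρ : V → ZMod 2) : Sym2 V → ZMod 2 :=
  Sym2.lift ⟨fun x y => if x = p ∧ y = p then ρ p else
    if (x = p ∨ x = b) ∧ y ∈ C ∧ y ≠ p ∧ y ≠ b then ρ y else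
    if (y = p ∨ y = b) ∧ x ∈ C ∧ x ≠ p ∧ x ≠ b then ρ x else 0, by
      intro x y
      by_cases hx : x = p <;> by_cases hy : y = p <;> by_cases hx' : x = b <;>
        by_cases hy' : y = b <;> simp_all⟩

lemma rowShift_mk (p b : V) (C : Finset V) (ρ : V → ZMod 2) (x y : V) :
    rowShift p b C ρ s(x, y) = if x = p ∧ y = p then ρ p else
      if (x = p ∨ x = b) ∧ y ∈ C ∧ y ≠ p ∧ y ≠ b then ρ y else
      if (y = p ∨ y = b) ∧ x ∈ C ∧ x ≠ p ∧ x ≠ b then ρ x else 0 := rfl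

lemma rowShift_eq_zero {p b x y : V} {C : Finset V} {ρ : V → ZMod 2} (hxp : x ≠ p) (hxb : x ≠ b)
    (hyp : y ≠ p) (hyb : y ≠ b) : rowShift p b C ρ s(x, y) = 0 := by
  simp [rowShift_mk, *]

section

variable {p b : V} {C : Finset V} (hp : p ∉ C) (hb : b ∉ C) (hpb : p ≠ b) (ρ : V → ZMod 2)

include hp hb

lemma rowShift_mk_of_mem {h : V} (hh : h ∈ C) (w : V) :
    rowShift p b C ρ s(h, w) = if w = p ∨ w = b then ρ h else 0 := by
  have h1 : h ≠ p := fun e => hp (e ▸ hh)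
  have h2 : h ≠ b := fun e => hb (e ▸ hh)
  simp [rowShift_mk, h1, h2, hh]

include hpb

/-- The entries added at `p` and at `b` cancel as long as both are present. The translation becomes
visible on `C` only after `p` is deleted, so it randomises the future without disturbing the past.
-/
lemma parDeg_rowShift_of_mem {S : Finset V} {h : V} (hh : h ∈ C) (hpS : p ∈ S) (hbS : b ∈ S) :
    parDeg (rowShift p b C ρ) S h = 0 := by
  unfold parDeg
  simp only [rowShift_mk_of_mem hp hb ρ hh]
  rw [← sum_filter]
  have : S.filter (fun w => w = p ∨ w = b) = {p, b} := by
    ext x; simp only [mem_filter, mem_insert, mem_singleton]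
    constructor
    · exact fun h => h.2
    · rintro (rfl | rfl) <;> simp [*]
  rw [this, sum_pair hpb, CharTwo.add_self_eq_zero]

lemma parDeg_rowShift_of_notMem {S : Finset V} {h : V} (hh : h ∈ C) (hpS : p ∉ S) (hbS : b ∈ S) :
    parDeg (rowShift p b C ρ) S h = ρ h := by
  unfold parDeg
  simp only [rowShift_mk_of_mem hp hb ρ hh]
  rw [← sum_filter]
  have : S.filter (fun w => w = p ∨ w = b) = {b} := by
    ext x; simp only [mem_filter, mem_singleton]
    constructor
    · rintro ⟨h1, rfl | h2⟩
      · exact absurd h1 hpS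
      · exact h2
    · rintro rfl; simp [*]
  rw [this, sum_singleton]

lemma parDeg_rowShift_self {S : Finset V} (hpS : p ∈ S) :
    parDeg (rowShift p b C ρ) S p = ρ p + ∑ w ∈ S with w ∈ C, ρ w := by
  unfold parDeg
  have : ∀ w, rowShift p b C ρ s(p, w) = (if w = p then ρ p else 0) + if w ∈ C then ρ w else 0 := by
    intro w
    by_cases h1 : w = p
    · subst h1; simp [rowShift_mk, hp]
    · by_cases h2 : w = b
      · subst h2; simp [rowShift_mk, hp, h1, hb]
      · by_cases h3 : w ∈ C <;> simp [rowShift_mk, hp, h1, h2, h3]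
  simp only [this, sum_add_distrib]
  rw [sum_ite_eq' S p, if_pos hpS, sum_filter]

end

/-- Some suffix of the list `ps` of fresh vertices, together with the background `B`, is reachable
from `T ∪ ps ∪ B`. -/
def Hit (M : Sym2 V → ZMod 2) (T : Finset V) (ps : List V) (B : Finset V) : Prop :=
  ∃ ps', ps' <:+ ps ∧ Reach M (T ∪ ps.toFinset ∪ B) (ps'.toFinset ∪ B)

lemma hit_empty (M : Sym2 V → ZMod 2) (ps : List V) (B : Finset V) : Hit M ∅ ps B :=
  ⟨ps, List.suffix_rfl, by rw [empty_union]; exact .refl _⟩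

/-- The vertices of `T` surviving one pass after removal of `p` from `S`. -/
noncomputable def survivors (M : Sym2 V → ZMod 2) (S : Finset V) (p : V) (T : Finset V) : List V :=
  pass (fun a b => M s(a, b)) (parDeg M (S.erase p)) T.toList

lemma survivors_subset (M : Sym2 V → ZMod 2) (S : Finset V) (p : V) (T : Finset V) :
    (survivors M S p T).toFinset ⊆ T := by
  intro x hx
  rw [List.mem_toFinset] at hx
  simpa using (pass_sublist _ _ _).subset hx

lemma card_survivors (M : Sym2 V → ZMod 2) (S : Finset V) (p : V) (T : Finset V) :
    (survivors M S p T).toFinset.card = (survivors M S p T).length :=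
  List.toFinset_card_of_nodup ((pass_sublist _ _ _).nodup T.nodup_toList)

/-- Weights invariant under the row translations at the vertices of `ps`. -/
def RowInvariant (b : V) (ps : List V) (C : Finset V) (φ : (Sym2 V → ZMod 2) → ℝ) : Prop :=
  ∀ p ∈ ps, ∀ C', C ⊆ C' → p ∉ C' → b ∉ C' → ∀ ρ M, φ (M + rowShift p b C' ρ) = φ M

lemma RowInvariant.ite {b : V} {ps : List V} {C : Finset V} {φ : (Sym2 V → ZMod 2) → ℝ}
    (hφ : RowInvariant b ps C φ) {P : (Sym2 V → ZMod 2) → Prop} [DecidablePred P]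
    (hP : ∀ p ∈ ps, ∀ C', C ⊆ C' → p ∉ C' → b ∉ C' → ∀ ρ M, P (M + rowShift p b C' ρ) ↔ P M) :
    RowInvariant b ps C fun M => if P M then φ M else 0 := by
  intro p hp C' h1 h2 h3 ρ M
  simp only [hP p hp C' h1 h2 h3, hφ p hp C' h1 h2 h3]

lemma survivors_shift {p b : V} {S T C : Finset V} (M : Sym2 V → ZMod 2) (hp : p ∉ C) (hb : b ∉ C)
    (hpb : p ≠ b) (hT : T ⊆ C) (hbS : b ∈ S) (ρ : V → ZMod 2) :
    survivors (M + rowShift p b C ρ) S p T =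
      pass (fun a b => M s(a, b)) (parDeg M (S.erase p) + ρ) T.toList := by
  refine pass_congr (fun x hx y hy => ?_) fun x hx => ?_
  · have hy' := hT (mem_toList.1 hy)
    rw [Pi.add_apply, rowShift_mk_of_mem hp hb ρ (hT (mem_toList.1 hx)), if_neg, add_zero]
    rintro (rfl | rfl) <;> contradiction
  · rw [parDeg_add, parDeg_rowShift_of_notMem hp hb hpb ρ (hT (mem_toList.1 hx)) (by simp)
      (by simp [hbS, hpb.symm])]
    rfl

lemma survivors_shift_of_mem {p q b : V} {S T C : Finset V} (M : Sym2 V → ZMod 2) (hq : q ∉ C)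
    (hb : b ∉ C) (hqb : q ≠ b) (hpC : p ∈ C) (hT : T ⊆ C) (hqS : q ∈ S) (hbS : b ∈ S)
    (ρ : V → ZMod 2) :
    survivors (M + rowShift q b C ρ) S p T = survivors M S p T := by
  have hqp : q ≠ p := fun e => hq (e ▸ hpC)
  have hbp : b ≠ p := fun e => hb (e ▸ hpC)
  refine pass_congr (fun x hx y hy => ?_) fun x hx => ?_
  · have hy' := hT (mem_toList.1 hy)
    rw [Pi.add_apply, rowShift_mk_of_mem hq hb ρ (hT (mem_toList.1 hx)), if_neg, add_zero]
    rintro (rfl | rfl) <;> contradiction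
  · rw [parDeg_add, parDeg_rowShift_of_mem hq hb hqb ρ (hT (mem_toList.1 hx)) (by simp [hqS, hqp])
      (by simp [hbS, hbp]), add_zero]

/-- Potential controlling the time until the carried set is exhausted. -/
noncomputable def potential (h : ℕ) : ℝ := 4 + h - 4 * 0 ^ h

lemma potential_nonneg (h : ℕ) : 0 ≤ potential h := by
  unfold potential
  rcases Nat.eq_zero_or_pos h with rfl | h0
  · simp
  · rw [zero_pow h0.ne', mul_zero, sub_zero]; positivity

lemma five_le_potential {h : ℕ} (h0 : 1 ≤ h) : 5 ≤ potential h := by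
  unfold potential
  rw [zero_pow (by omega)]
  have : (1 : ℝ) ≤ h := by exact_mod_cast h0
  linarith

/-- With probability `1/2` the carried set grows by one, otherwise it is thinned by fair coins. For
`h ≥ 4` halving suffices; for smaller `h` the chance `2 ^ (-h)` of emptying, rewarded by the jump of
the potential at `0`, is needed. -/
lemma potential_drift {h : ℕ} (h0 : 1 ≤ h) :
    (potential (h + 1) + (4 + h / 2 - 4 / 2 ^ h)) / 2 ≤ (79 / 80 : ℝ) ^ 4 * potential h := by
  have h1 : (19 / 20 : ℝ) ≤ (79 / 80) ^ 4 := by norm_num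
  refine le_trans ?_ (mul_le_mul_of_nonneg_right h1 (potential_nonneg h))
  unfold potential
  rw [zero_pow (by omega), zero_pow (by omega)]
  push_cast
  by_cases h4 : 4 ≤ h
  · have : (4 : ℝ) ≤ h := by exact_mod_cast h4
    have : 0 < 4 / (2 : ℝ) ^ h := by positivity
    linarith
  · interval_cases h <;> norm_num

variable [Fintype V]

open Classical in
/-- A carried set `T` is exhausted at some time while processing the fresh vertices `ps`, except
with exponentially small conditional probability. -/
theorem sum_not_hit_le {b : V} {B : Finset V} (hbB : b ∈ B) (ps : List V) (hps : ps.Nodup)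
    (hpsB : ∀ p ∈ ps, p ∉ B) (C T : Finset V) (hTC : T ⊆ C) (hpsC : ∀ p ∈ ps, p ∉ C)
    (hCB : Disjoint C B) (φ : (Sym2 V → ZMod 2) → ℝ) (hφ0 : ∀ M, 0 ≤ φ M)
    (hφ : RowInvariant b ps C φ) :
    ∑ M, (if Hit M T ps B then 0 else φ M) ≤
      ((79 / 80 : ℝ) ^ 4) ^ ps.length * potential T.card / 5 * ∑ M, φ M := by
  induction ps generalizing C T φ with
  | nil =>
    rcases T.eq_empty_or_nonempty with rfl | hT
    · simp [hit_empty, potential]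
    · have h5 := five_le_potential (card_pos.2 hT)
      calc ∑ M, (if Hit M T [] B then 0 else φ M) ≤ ∑ M, φ M :=
            sum_le_sum fun M _ => by split_ifs <;> simp [hφ0]
        _ ≤ _ := by
            refine le_mul_of_one_le_left (sum_nonneg fun M _ => hφ0 M) ?_
            simp only [List.length_nil, pow_zero, one_mul]
            linarith
  | cons p ps ih =>
    rcases T.eq_empty_or_nonempty with rfl | hT
    · simp [hit_empty, potential]
    rw [List.nodup_cons] at hps
    have hpC : p ∉ C := hpsC p (by simp)
    have hpB : p ∉ B := hpsB p (by simp)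
    have hpb : p ≠ b := fun e => hpB (e ▸ hbB)
    have hpT : p ∉ T := fun h => hpC (hTC h)
    have hbC : b ∉ C := fun h => disjoint_left.1 hCB h hbB
    set S : Finset V := T ∪ (p :: ps).toFinset ∪ B with hS
    have hpS : p ∈ S := by simp [hS]
    have hbS : b ∈ S := by simp [hS, hbB]
    have hC' : ∀ q ∈ ps, q ∉ insert p C := fun q hq => by
      rw [mem_insert, not_or]
      exact ⟨fun e => hps.1 (e ▸ hq), hpsC q (by simp [hq])⟩
    have hC'B : Disjoint (insert p C) B := by
      rw [disjoint_insert_left]; exact ⟨hpB, hCB⟩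
    have hφ' : RowInvariant b ps (insert p C) φ := fun q hq C' h1 =>
      hφ q (by simp [hq]) C' ((subset_insert _ _).trans h1)
    have hSe : S.erase p = T.toList.toFinset ∪ (ps.toFinset ∪ B) := by
      ext x
      simp only [hS, mem_erase, mem_union, List.mem_toFinset, List.mem_cons, mem_toList]
      constructor
      · tauto
      · rintro (h | h | h)
        · exact ⟨fun e => hpT (e ▸ h), by tauto⟩
        · exact ⟨fun e => hps.1 (e ▸ h), by tauto⟩
        · exact ⟨fun e => hpB (e ▸ h), by tauto⟩
    -- the parity of `p` and the survivors are not affected by later translations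
    have hinv1 : ∀ q ∈ ps, ∀ C', insert p C ⊆ C' → q ∉ C' → b ∉ C' → ∀ ρ M,
        parDeg (M + rowShift q b C' ρ) S p = parDeg M S p := by
      intro q hq C' h1 h2 h3 ρ M
      rw [parDeg_add, parDeg_rowShift_of_mem h2 h3 (fun e => hpsB q (by simp [hq]) (e ▸ hbB)) ρ
        (h1 (mem_insert_self _ _)) (by simp [hS, hq]) hbS, add_zero]
    have hinv2 : ∀ q ∈ ps, ∀ C', insert p C ⊆ C' → q ∉ C' → b ∉ C' → ∀ ρ M,
        survivors (M + rowShift q b C' ρ) S p T = survivors M S p T := by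
      intro q hq C' h1 h2 h3 ρ M
      exact survivors_shift_of_mem M h2 h3 (fun e => hpsB q (by simp [hq]) (e ▸ hbB))
        (h1 (mem_insert_self _ _)) (hTC.trans ((subset_insert _ _).trans h1)) (by simp [hS, hq])
        hbS ρ
    -- Split by what happens at `p`: it joins the carried set, or it is deleted and `T` thins to
    -- `X`. Both conditions are invariant under later translations, so the induction hypothesis
    -- applies to the restricted weights.
    set φ₁ : (Sym2 V → ZMod 2) → ℝ := fun M => if parDeg M S p = 1 then φ M else 0 with hφ₁
    set φ₂ : Finset V → (Sym2 V → ZMod 2) → ℝ := fun X M =>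
      if parDeg M S p = 0 ∧ (survivors M S p T).toFinset = X then φ M else 0 with hφ₂
    have ih1 := ih hps.2 (fun q hq => hpsB q (by simp [hq])) (insert p C) (insert p T)
      (insert_subset_insert _ hTC) hC' hC'B φ₁ (fun M => by simp only [hφ₁]; split_ifs <;> simp [hφ0])
      (hφ'.ite (P := fun M => parDeg M S p = 1) fun q hq C' h1 h2 h3 ρ M => by
        simp only [hinv1 q hq C' h1 h2 h3])
    have ih2 : ∀ X ∈ T.powerset, _ := fun X hX =>
      ih hps.2 (fun q hq => hpsB q (by simp [hq])) (insert p C) X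
      ((mem_powerset.1 hX).trans (hTC.trans (subset_insert _ _))) hC' hC'B (φ₂ X)
      (fun M => by simp only [hφ₂]; split_ifs <;> simp [hφ0])
      (hφ'.ite (P := fun M => parDeg M S p = 0 ∧ (survivors M S p T).toFinset = X)
        fun q hq C' h1 h2 h3 ρ M => by
        simp only [hinv1 q hq C' h1 h2 h3, hinv2 q hq C' h1 h2 h3])
    set G : (Sym2 V → ZMod 2) → ℝ := fun M =>
      if parDeg M S p = 0 then potential (survivors M S p T).length else potential (T.card + 1)
      with hG
    have hpoint : ∀ M, (if Hit M T (p :: ps) B then 0 else φ M) ≤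
        (if Hit M (insert p T) ps B then 0 else φ₁ M) +
          ∑ X ∈ T.powerset, (if Hit M X ps B then 0 else φ₂ X M) := by
      intro M
      have hn1 : 0 ≤ (if Hit M (insert p T) ps B then 0 else φ₁ M) := by
        simp only [hφ₁]; split_ifs <;> simp [hφ0]
      have hn2 : ∀ X ∈ T.powerset, 0 ≤ (if Hit M X ps B then 0 else φ₂ X M) := fun X _ => by
        simp only [hφ₂]; split_ifs <;> simp [hφ0]
      by_cases hH : Hit M T (p :: ps) B
      · rw [if_pos hH]; exact add_nonneg hn1 (sum_nonneg hn2)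
      rw [if_neg hH]
      by_cases hd : parDeg M S p = 0
      · have hX := mem_powerset.2 (survivors_subset M S p T)
        refine le_trans ?_ (le_add_of_nonneg_left hn1)
        refine le_trans ?_ (single_le_sum hn2 hX)
        rw [if_neg, hφ₂]
        · simp [hd]
        · rintro ⟨ps', h1, h2⟩
          refine hH ⟨ps', h1.trans (List.suffix_cons _ _), .step hpS hd ?_⟩
          rw [hSe]
          refine (reach_pass M T.toList (ps.toFinset ∪ B) (parDeg M (S.erase p)) T.nodup_toList ?_
            ?_).trans ?_
          · intro x hx
            have hx := mem_toList.1 hx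
            rw [mem_union, not_or, List.mem_toFinset]
            exact ⟨fun h => hpsC x (by simp [h]) (hTC hx), fun h => disjoint_left.1 hCB (hTC hx) h⟩
          · intro x _; rw [hSe]
          · rw [← union_assoc]; exact h2
      · refine le_trans ?_ (le_add_of_nonneg_right (sum_nonneg hn2))
        rw [if_neg, hφ₁]
        · simp [zmod_two_ne_zero.1 hd]
        · rintro ⟨ps', h1, h2⟩
          refine hH ⟨ps', h1.trans (List.suffix_cons _ _), ?_⟩
          convert h2 using 1
          ext x; simp
    have hsum : ∑ M, (if Hit M T (p :: ps) B then 0 else φ M) ≤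
        ((79 / 80 : ℝ) ^ 4) ^ ps.length / 5 * ∑ M, φ M * G M := by
      calc ∑ M, (if Hit M T (p :: ps) B then 0 else φ M)
          ≤ ∑ M, (if Hit M (insert p T) ps B then 0 else φ₁ M) +
            ∑ X ∈ T.powerset, ∑ M, (if Hit M X ps B then 0 else φ₂ X M) := by
            rw [sum_comm, ← sum_add_distrib]
            exact sum_le_sum fun M _ => hpoint M
        _ ≤ _ := add_le_add ih1 (sum_le_sum ih2)
        _ = ((79 / 80 : ℝ) ^ 4) ^ ps.length / 5 * (∑ M, potential (T.card + 1) * φ₁ M +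
            ∑ M, ∑ X ∈ T.powerset, potential X.card * φ₂ X M) := by
            rw [sum_comm (s := univ), mul_add, card_insert_of_notMem hpT]
            simp only [mul_sum]
            congr 1
            · exact sum_congr rfl fun M _ => by ring
            · exact sum_congr rfl fun X _ => sum_congr rfl fun M _ => by ring
        _ = _ := by
            rw [← sum_add_distrib]
            congr 1
            refine sum_congr rfl fun M _ => ?_
            by_cases hd : parDeg M S p = 0
            · rw [sum_eq_single_of_mem _ (mem_powerset.2 (survivors_subset M S p T))]
              · simp [hφ₁, hφ₂, hG, hd, card_survivors, mul_comm]
              · intro X _ hX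
                simp [hφ₂, Ne.symm hX]
            · simp [hφ₁, hφ₂, hG, zmod_two_ne_zero.1 hd, mul_comm]
    -- Along the translations at `p`, the diagonal value `ρ p` is a fair coin for the parity of `p`,
    -- and the values of `ρ` on `T` randomise the parities met by the pass.
    have havg : ∀ M, ∑ ρ, G (M + rowShift p b C ρ) ≤
        2 ^ Fintype.card V * ((79 / 80 : ℝ) ^ 4 * potential T.card) := by
      intro M
      set pl : (V → ZMod 2) → ℕ := fun ρ =>
        (pass (fun a b => M s(a, b)) (parDeg M (S.erase p) + ρ) T.toList).length with hpl
      have hGρ : ∀ ρ, G (M + rowShift p b C ρ) =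
          if parDeg M S p + (ρ p + ∑ w ∈ S with w ∈ C, ρ w) = 0 then potential (pl ρ)
          else potential (T.card + 1) := fun ρ => by
        simp only [hG, hpl, survivors_shift M hpC hbC hpb hTC hbS, parDeg_add,
          parDeg_rowShift_self hpC hbC hpb ρ hpS]
      have hflip : ∀ ρ, G (M + rowShift p b C ρ) + G (M + rowShift p b C (ρ + Pi.single p 1)) =
          potential (pl ρ) + potential (T.card + 1) := by
        intro ρ
        have hs : ∀ x ∈ C, (Pi.single p (1 : ZMod 2) : V → ZMod 2) x = 0 := fun x hx =>
          Pi.single_eq_of_ne (fun e => hpC (by rw [← e]; exact hx)) _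
        have e1 : pl (ρ + Pi.single p 1) = pl ρ := by
          simp only [hpl]
          refine congrArg List.length (pass_congr (fun _ _ _ _ => rfl) fun x hx => ?_)
          simp [hs x (hTC (mem_toList.1 hx))]
        have e2 : ∑ w ∈ S with w ∈ C, (ρ + Pi.single p 1 : V → ZMod 2) w =
            ∑ w ∈ S with w ∈ C, ρ w :=
          sum_congr rfl fun x hx => by simp [hs x (mem_filter.1 hx).2]
        rw [hGρ, hGρ, e1, e2, Pi.add_apply, Pi.single_eq_same]
        set u := parDeg M S p + (ρ p + ∑ w ∈ S with w ∈ C, ρ w) with hu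
        have e3 : parDeg M S p + (ρ p + 1 + ∑ w ∈ S with w ∈ C, ρ w) = u + 1 := by
          rw [hu]; ring
        rw [e3]
        by_cases hu0 : u = 0
        · rw [if_pos hu0, if_neg (by rw [hu0]; decide)]
        · rw [if_neg hu0, if_pos (by rw [zmod_two_ne_zero.1 hu0]; rfl), add_comm]
      rw [sum_flip p]
      simp only [hflip, sum_add_distrib]
      have := sum_pass (fun a b => M s(a, b)) T.toList T.nodup_toList (parDeg M (S.erase p)) 4 4
      simp only [potential] at this ⊢
      rw [this, length_toList]
      have hdr := potential_drift (card_pos.2 hT)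
      simp only [potential] at hdr
      have h2 : (0 : ℝ) < 2 ^ Fintype.card V := by positivity
      simp only [sum_const, card_univ, Fintype.card_fun, ZMod.card, nsmul_eq_mul]
      push_cast at hdr ⊢
      nlinarith
    -- Since `φ` is invariant under the translations at `p`, `G` may be replaced by its average over
    -- them.
    have hmean : ∑ M, φ M * G M ≤ (79 / 80 : ℝ) ^ 4 * potential T.card * ∑ M, φ M := by
      have h2 : (0 : ℝ) < 2 ^ Fintype.card V := by positivity
      have h1 : ∀ ρ, ∑ M, φ M * G M = ∑ M, φ M * G (M + rowShift p b C ρ) := by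
        intro ρ
        rw [← Equiv.sum_comp (Equiv.addRight (rowShift p b C ρ))]
        refine sum_congr rfl fun M _ => ?_
        simp only [Equiv.coe_addRight]
        rw [hφ p (by simp) C subset_rfl hpC hbC]
      have h3 : 2 ^ Fintype.card V * ∑ M, φ M * G M =
          ∑ M, φ M * ∑ ρ, G (M + rowShift p b C ρ) := by
        simp only [mul_sum (s := (univ : Finset (V → ZMod 2)))]
        rw [sum_comm, ← sum_congr rfl fun ρ _ => h1 ρ]
        simp
      have h4 : 2 ^ Fintype.card V * ∑ M, φ M * G M ≤
          2 ^ Fintype.card V * ((79 / 80 : ℝ) ^ 4 * potential T.card * ∑ M, φ M) := by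
        rw [h3, ← mul_assoc, mul_sum]
        refine sum_le_sum fun M _ => ?_
        rw [mul_comm]
        exact mul_le_mul_of_nonneg_right (havg M) (hφ0 M)
      exact le_of_mul_le_mul_left h4 h2
    calc _ ≤ _ := hsum
      _ ≤ ((79 / 80 : ℝ) ^ 4) ^ ps.length / 5 *
          ((79 / 80 : ℝ) ^ 4 * potential T.card * ∑ M, φ M) :=
          mul_le_mul_of_nonneg_left hmean (by positivity)
      _ = _ := by rw [List.length_cons, pow_succ]; ring

end

/-! ### Second moments of deletion orders -/

section

variable {V : Type*} [DecidableEq V]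

/-- The quadratic form of `M` evaluated at the indicator of `S`. -/
def quad (M : Sym2 V → ZMod 2) (S : Finset V) : ZMod 2 := ∑ z ∈ S.sym2, M z

/-- The pairs from `S` lost with `v`, the diagonal one included, form the row of `v`. Hence legal
deletions are those that preserve the form. -/
lemma quad_eq (M : Sym2 V → ZMod 2) {S : Finset V} {v : V} (hv : v ∈ S) :
    quad M S = quad M (S.erase v) + parDeg M S v := by
  have h1 : S.sym2 = (S.erase v).sym2 ∪ S.image (fun w => s(v, w)) := by
    ext z
    induction z with | _ x y =>
    simp only [mem_sym2_iff, Sym2.mem_iff, mem_union, mem_image, Sym2.eq_iff, mem_erase,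
      forall_eq_or_imp, forall_eq]
    constructor
    · rintro ⟨hx, hy⟩
      by_cases hxv : x = v
      · exact .inr ⟨y, hy, .inl ⟨hxv.symm, rfl⟩⟩
      · by_cases hyv : y = v
        · exact .inr ⟨x, hx, .inr ⟨hyv.symm, rfl⟩⟩
        · exact .inl ⟨⟨hxv, hx⟩, hyv, hy⟩
    · rintro (⟨⟨-, hx⟩, -, hy⟩ | ⟨w, hw, ⟨rfl, rfl⟩ | ⟨rfl, rfl⟩⟩)
      · exact ⟨hx, hy⟩
      · exact ⟨hv, hw⟩
      · exact ⟨hw, hv⟩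
  have h2 : Disjoint (S.erase v).sym2 (S.image (fun w => s(v, w))) := by
    rw [disjoint_left]
    intro z hz hz'
    obtain ⟨w, -, rfl⟩ := mem_image.1 hz'
    simp at hz
  unfold quad parDeg
  rw [h1, sum_union h2, sum_image]
  intro a _ b _ hab
  exact Sym2.congr_right.1 hab

lemma quad_add_single (M : Sym2 V → ZMod 2) (S : Finset V) (z : Sym2 V) :
    quad (M + Pi.single z 1) S = quad M S + if z ∈ S.sym2 then 1 else 0 := by
  simp only [quad, Pi.add_apply, sum_add_distrib, Finset.sum_pi_single']

/-- The normalised number of removal orders of `A` along which the quadratic form is constantly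
equal to `ε`. -/
noncomputable def orderWeight (ε : ZMod 2) (M : Sym2 V → ZMod 2) : ℕ → Finset V → ℝ
  | 0, _ => 1
  | k + 1, A => if quad M A = ε then 2 / (k + 1 : ℝ) * ∑ v ∈ A, orderWeight ε M k (A.erase v) else 0

lemma orderWeight_add_single (ε : ZMod 2) (M : Sym2 V → ZMod 2) (k : ℕ) (A : Finset V) (z : Sym2 V)
    (hz : z ∉ A.sym2) : orderWeight ε (M + Pi.single z 1) k A = orderWeight ε M k A := by
  induction k generalizing A with
  | zero => rfl
  | succ k ih =>
    rw [orderWeight, orderWeight, quad_add_single, if_neg hz, add_zero]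
    congr 2
    exact sum_congr rfl fun v _ => ih _ fun h => hz (sym2_mono (erase_subset _ _) h)

lemma exists_reach_of_orderWeight {ε : ZMod 2} {M : Sym2 V → ZMod 2} (k : ℕ) (A : Finset V)
    (hA : A.card = k) (h : orderWeight ε M k A ≠ 0) : ∃ S', S'.card ≤ 1 ∧ Reach M A S' := by
  induction k generalizing A with
  | zero => exact ⟨A, by omega, .refl _⟩
  | succ k ih =>
    -- Size one is already final; `orderWeight` puts no condition on the empty set, where the form
    -- is `0` whatever `ε` is.
    rcases Nat.eq_zero_or_pos k with rfl | hk
    · exact ⟨A, by omega, .refl _⟩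
    rw [orderWeight] at h
    have hq : quad M A = ε := by
      by_contra hq; simp [hq] at h
    rw [if_pos hq] at h
    obtain ⟨v, hv, hvne⟩ := exists_ne_zero_of_sum_ne_zero (right_ne_zero_of_mul h)
    have hc : (A.erase v).card = k := by rw [card_erase_of_mem hv]; omega
    obtain ⟨S', h1, h2⟩ := ih _ hc hvne
    refine ⟨S', h1, .step hv ?_ h2⟩
    have hq' : quad M (A.erase v) = ε := by
      obtain ⟨j, rfl⟩ : ∃ j, k = j + 1 := ⟨k - 1, by omega⟩
      rw [orderWeight] at hvne
      by_contra hq; simp [hq] at hvne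
    have := quad_eq M hv
    rw [hq, hq'] at this
    simpa using this

/-- The probability that a uniformly random maximal chain of subsets below `A` contains `D`. -/
noncomputable def chainProb (A D : Finset V) : ℝ := if D ⊆ A then ((A.card.choose D.card : ℕ) : ℝ)⁻¹ else 0

lemma chainProb_nonneg (A D : Finset V) : 0 ≤ chainProb A D := by
  unfold chainProb; split_ifs <;> positivity

/-- First-step identity for the random chain: it starts by deleting a uniform vertex of `A`, and it
can meet `D` only afterwards because `D` is smaller. -/
lemma sum_chainProb_erase {A D : Finset V} (hD : D.card < A.card) :
    ∑ v ∈ A, chainProb (A.erase v) D = A.card * chainProb A D := by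
  obtain ⟨k, hk⟩ : ∃ k, A.card = k + 1 := ⟨A.card - 1, by omega⟩
  by_cases hDA : D ⊆ A
  · have h1 : ∀ v ∈ A, chainProb (A.erase v) D =
        if v ∈ D then 0 else ((k.choose D.card : ℕ) : ℝ)⁻¹ := by
      intro v hv
      have : (A.erase v).card = k := by rw [card_erase_of_mem hv]; omega
      unfold chainProb
      by_cases hvD : v ∈ D <;> simp [hvD, hDA, this, subset_erase]
    rw [sum_congr rfl h1, sum_ite, sum_const_zero, zero_add, sum_const, nsmul_eq_mul]
    have h2 : (A.filter (fun v => v ∉ D)).card = k + 1 - D.card := by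
      rw [← hk, ← card_sdiff_of_subset hDA]
      congr 1; ext x; simp
    rw [h2, chainProb, if_pos hDA, hk]
    have h3 := Nat.choose_mul_succ_eq k D.card
    have h4 : 0 < k.choose D.card := Nat.choose_pos (by omega)
    have h5 : 0 < (k + 1).choose D.card := Nat.choose_pos (by omega)
    have h6 : ((k.choose D.card : ℕ) : ℝ) * ((k + 1 : ℕ) : ℝ) =
      ((k + 1).choose D.card : ℕ) * ((k + 1 - D.card : ℕ) : ℝ) := by exact_mod_cast h3
    field_simp
    linarith
  · rw [chainProb, if_neg hDA, mul_zero]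
    refine sum_eq_zero fun v _ => ?_
    rw [chainProb, if_neg fun h => hDA (h.trans (erase_subset _ _))]

/-- Upper bounds for the second moments of the normalised numbers of removal orders. -/
noncomputable def momentBound : ℕ → ℝ
  | k => 2 * (1 + ∑ j : Fin k, if (j : ℕ) = 0 then 0 else momentBound j / (k.choose j : ℕ))
termination_by k => k
decreasing_by exact j.2

lemma momentBound_eq (k : ℕ) :
    momentBound k = 2 * (1 + ∑ j ∈ Ico 1 k, momentBound j / (k.choose j : ℕ)) := by
  rw [momentBound, Fin.sum_univ_eq_sum_range
    (fun j => if j = 0 then 0 else momentBound j / (k.choose j : ℕ)) k]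
  congr 2
  rw [sum_ite, sum_const_zero, zero_add]
  refine sum_congr ?_ fun _ _ => rfl
  ext x; simp; omega

lemma two_le_momentBound (k : ℕ) : 2 ≤ momentBound k := by
  induction k using Nat.strong_induction_on with
  | _ k ih =>
    rw [momentBound_eq]
    have : 0 ≤ ∑ j ∈ Ico 1 k, momentBound j / (k.choose j : ℕ) :=
      sum_nonneg fun j hj => div_nonneg (by linarith [ih j (mem_Ico.1 hj).2]) (by positivity)
    linarith

variable [Fintype V]

/-- Flipping the entry `z` pairs the matrices satisfying `P` with the others. The independence used
in the moment computations comes from finding an entry seen by one form and by nothing else in the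
product. -/
lemma sum_ite_flip {P : (Sym2 V → ZMod 2) → Prop} [DecidablePred P] (z : Sym2 V)
    (hP : ∀ M, P (M + Pi.single z 1) ↔ ¬ P M) (F : (Sym2 V → ZMod 2) → ℝ)
    (hF : ∀ M, F (M + Pi.single z 1) = F M) :
    ∑ M, (if P M then F M else 0) = (∑ M, F M) / 2 := by
  have h1 : ∑ M, (if P M then F M else 0) = ∑ M, (if P M then 0 else F M) := by
    rw [← Equiv.sum_comp (Equiv.addRight (Pi.single z 1 : Sym2 V → ZMod 2))]
    refine sum_congr rfl fun M _ => ?_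
    simp only [Equiv.coe_addRight, hF, hP]
    by_cases h : P M <;> simp [h]
  have h2 : ∑ M, (if P M then F M else 0) + ∑ M, (if P M then 0 else F M) = ∑ M, F M := by
    rw [← sum_add_distrib]
    refine sum_congr rfl fun M _ => ?_
    by_cases h : P M <;> simp [h]
  linarith

lemma quad_flip {S : Finset V} {z : Sym2 V} (hz : z ∈ S.sym2) (ε : ZMod 2)
    (M : Sym2 V → ZMod 2) : quad (M + Pi.single z 1) S = ε ↔ ¬ quad M S = ε := by
  rw [quad_add_single, if_pos hz]
  generalize quad M S = a
  revert a ε; decide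

lemma sum_orderWeight (ε : ZMod 2) (k : ℕ) (A : Finset V) (hA : A.card = k) :
    ∑ M, orderWeight ε M k A = Fintype.card (Sym2 V → ZMod 2) := by
  induction k generalizing A with
  | zero => simp [orderWeight]
  | succ k ih =>
    have h1 : ∀ M, orderWeight ε M (k + 1) A = 2 / (k + 1 : ℝ) *
        ∑ v ∈ A, if quad M A = ε then orderWeight ε M k (A.erase v) else 0 := by
      intro M; rw [orderWeight]; split_ifs <;> simp
    simp only [h1, ← mul_sum]
    rw [sum_comm]
    have h2 : ∀ v ∈ A, ∑ M, (if quad M A = ε then orderWeight ε M k (A.erase v) else 0) =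
        (Fintype.card (Sym2 V → ZMod 2) : ℝ) / 2 := by
      intro v hv
      rw [sum_ite_flip s(v, v) (fun M => quad_flip (by simpa using hv) ε M), ih]
      · rw [card_erase_of_mem hv]; omega
      · intro M; exact orderWeight_add_single _ _ _ _ _ (by simp)
    rw [sum_congr rfl h2, sum_const, hA, nsmul_eq_mul]
    push_cast
    field_simp

/-- The sum of the products of the weights of two sets. -/
noncomputable def pairMoment (ε : ZMod 2) (k : ℕ) (A A' : Finset V) : ℝ :=
  ∑ M, orderWeight ε M k A * orderWeight ε M k A'

lemma pairMoment_succ_eq (ε : ZMod 2) (k : ℕ) (A A' : Finset V) :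
    pairMoment ε (k + 1) A A' = (2 / (k + 1 : ℝ)) ^ 2 * ∑ v ∈ A, ∑ w ∈ A',
      ∑ M, if quad M A = ε then (if quad M A' = ε then
        orderWeight ε M k (A.erase v) * orderWeight ε M k (A'.erase w) else 0) else 0 := by
  unfold pairMoment
  have h1 : ∀ M, orderWeight ε M (k + 1) A * orderWeight ε M (k + 1) A' =
      (2 / (k + 1 : ℝ)) ^ 2 * ∑ v ∈ A, ∑ w ∈ A',
      if quad M A = ε then (if quad M A' = ε then
        orderWeight ε M k (A.erase v) * orderWeight ε M k (A'.erase w) else 0) else 0 := by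
    intro M
    rw [orderWeight, orderWeight]
    split_ifs
    · rw [← sum_mul_sum]; ring
    all_goals simp
  simp only [h1, ← mul_sum]
  congr 1
  rw [sum_comm]
  exact sum_congr rfl fun v _ => sum_comm

lemma pairMoment_succ_self (ε : ZMod 2) (k : ℕ) (A : Finset V) :
    pairMoment ε (k + 1) A A = 2 * (((k + 1 : ℝ) ^ 2)⁻¹ * ∑ v ∈ A, ∑ w ∈ A,
      pairMoment ε k (A.erase v) (A.erase w)) := by
  rw [pairMoment_succ_eq]
  have h : ∀ v ∈ A, ∀ w ∈ A, ∑ M, (if quad M A = ε then (if quad M A = ε then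
        orderWeight ε M k (A.erase v) * orderWeight ε M k (A.erase w) else 0) else 0) =
      pairMoment ε k (A.erase v) (A.erase w) / 2 := by
    intro v hv w hw
    -- The entry `(v, w)` is seen by the form on `A`, but lies in neither `A.erase v` nor `A.erase
    -- w`.
    have hz : s(v, w) ∈ A.sym2 := by simp [hv, hw]
    rw [pairMoment, ← sum_ite_flip (P := fun M => quad M A = ε) s(v, w) (fun M => quad_flip hz ε M)]
    · refine sum_congr rfl fun M _ => ?_
      split_ifs <;> rfl
    · intro M
      rw [orderWeight_add_single _ _ _ _ _ (by simp), orderWeight_add_single _ _ _ _ _ (by simp)]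
  rw [sum_congr rfl fun v hv => sum_congr rfl fun w hw => h v hv w hw]
  simp only [← sum_div]
  field_simp

/-- Distinct sets of equal size each have a vertex the other misses, so two entries flip the two
forms separately. The resulting `1/4` cancels the squared normalisation and leaves a plain average;
for equal sets a factor `2` remains. -/
lemma pairMoment_succ_of_ne (ε : ZMod 2) (k : ℕ) {A A' : Finset V} (hAA' : A ≠ A')
    (hc : A.card = A'.card) :
    pairMoment ε (k + 1) A A' = ((k + 1 : ℝ) ^ 2)⁻¹ * ∑ v ∈ A, ∑ w ∈ A',
      pairMoment ε k (A.erase v) (A'.erase w) := by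
  rw [pairMoment_succ_eq]
  obtain ⟨u, hu, hu'⟩ := not_subset.1 fun h => hAA' (eq_of_subset_of_card_le h hc.ge)
  obtain ⟨x, hx, hx'⟩ := not_subset.1 fun h => hAA' (eq_of_subset_of_card_le h hc.le).symm
  have h : ∀ v ∈ A, ∀ w ∈ A', ∑ M, (if quad M A = ε then (if quad M A' = ε then
        orderWeight ε M k (A.erase v) * orderWeight ε M k (A'.erase w) else 0) else 0) =
      pairMoment ε k (A.erase v) (A'.erase w) / 4 := by
    intro v hv w hw
    have hz : s(v, u) ∈ A.sym2 := by simp [hv, hu]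
    have hz' : s(w, x) ∈ A'.sym2 := by simp [hw, hx]
    have hz'' : s(v, u) ∉ A'.sym2 := by simp [hu']
    rw [sum_ite_flip s(v, u) (fun M => quad_flip hz ε M),
      sum_ite_flip s(w, x) (fun M => quad_flip hz' ε M), pairMoment]
    · ring
    · intro M
      rw [orderWeight_add_single _ _ _ _ _ (by simp [hx']),
        orderWeight_add_single _ _ _ _ _ (by simp)]
    · intro M
      rw [orderWeight_add_single _ _ _ _ _ (by simp),
        orderWeight_add_single _ _ _ _ _ (by simp [hu']), quad_add_single, if_neg hz'', add_zero]
  rw [sum_congr rfl fun v hv => sum_congr rfl fun w hw => h v hv w hw]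
  simp only [← sum_div]
  field_simp
  ring

/-- Upper bound for the correlation of the weights of two distinct sets. -/
noncomputable def corrBound (k : ℕ) (A A' : Finset V) : ℝ :=
  1 + ∑ j ∈ Ico 1 k, ∑ D ∈ powersetCard j univ, chainProb A D * chainProb A' D * momentBound j

lemma corrBound_self (k : ℕ) (A : Finset V) (hA : A.card = k) :
    2 * corrBound k A A = momentBound k := by
  rw [momentBound_eq, corrBound]
  congr 2
  refine sum_congr rfl fun j hj => ?_
  rw [mem_Ico] at hj
  have h1 : ∑ D ∈ powersetCard j univ, chainProb A D * chainProb A D * momentBound j =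
      ∑ D ∈ powersetCard j A, ((k.choose j : ℕ) : ℝ)⁻¹ * ((k.choose j : ℕ) : ℝ)⁻¹ * momentBound j := by
    symm
    refine sum_subset_zero_on_sdiff (powersetCard_mono (subset_univ _)) ?_ ?_
    · intro D hD
      simp only [mem_sdiff, mem_powersetCard, subset_univ, true_and] at hD
      have : ¬ D ⊆ A := fun h => hD.2 ⟨h, hD.1⟩
      simp [chainProb, this]
    · intro D hD
      rw [mem_powersetCard] at hD
      simp [chainProb, hD.1, hD.2, hA]
  rw [h1, sum_const, card_powersetCard, hA, nsmul_eq_mul]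
  have : (0 : ℝ) < (k.choose j : ℕ) := by exact_mod_cast Nat.choose_pos hj.2.le
  field_simp

lemma avg_corrBound (k : ℕ) (A A' : Finset V) (hA : A.card = k + 1) (hA' : A'.card = k + 1) :
    ((k + 1 : ℝ) ^ 2)⁻¹ * ∑ v ∈ A, ∑ w ∈ A', corrBound (k + 1) (A.erase v) (A'.erase w) =
      corrBound (k + 1) A A' := by
  unfold corrBound
  simp only [sum_add_distrib, sum_const, nsmul_eq_mul, mul_one, hA, hA']
  have h1 : ∑ v ∈ A, ∑ w ∈ A', ∑ j ∈ Ico 1 (k + 1), ∑ D ∈ powersetCard j univ,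
      chainProb (A.erase v) D * chainProb (A'.erase w) D * momentBound j =
      ∑ j ∈ Ico 1 (k + 1), ∑ D ∈ powersetCard j univ,
        (k + 1 : ℝ) ^ 2 * (chainProb A D * chainProb A' D * momentBound j) := by
    simp only [sum_comm (t := Ico 1 (k + 1))]
    refine sum_congr rfl fun j hj => ?_
    rw [mem_Ico] at hj
    simp only [sum_comm (t := powersetCard j (univ : Finset V))]
    refine sum_congr rfl fun D hD => ?_
    rw [mem_powersetCard] at hD
    simp only [← sum_mul]
    rw [← sum_mul_sum, sum_chainProb_erase (by omega), sum_chainProb_erase (by omega), hA, hA']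
    push_cast
    ring
  rw [h1]
  simp only [← mul_sum]
  push_cast
  field_simp

/-- Run independent random chains from `A` and `A'`: correlation arises only once they meet, and a
meeting at `D` is charged the second moment bound for `D`. The index `k + 1` in `corrBound` admits
`D` of size `k`, so the first bound also covers `A = A'` and can be averaged in the induction. -/
lemma pairMoment_le (ε : ZMod 2) (k : ℕ) (A A' : Finset V) (hA : A.card = k) (hA' : A'.card = k) :
    pairMoment ε k A A' ≤
      corrBound (k + 1) A A' * Fintype.card (Sym2 V → ZMod 2) ∧
    (A = A' → pairMoment ε k A A' ≤ momentBound k * Fintype.card (Sym2 V → ZMod 2)) := by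
  induction k generalizing A A' with
  | zero =>
    have h : pairMoment ε 0 A A' = Fintype.card (Sym2 V → ZMod 2) := by
      simp [pairMoment, orderWeight]
    rw [h]
    refine ⟨by simp [corrBound], fun _ => ?_⟩
    exact le_mul_of_one_le_left (by positivity) (by linarith [two_le_momentBound 0])
  | succ k ih =>
    set N := (Fintype.card (Sym2 V → ZMod 2) : ℝ) with hN
    have hN0 : 0 ≤ N := by positivity
    have hmono : corrBound (k + 1) A A' ≤ corrBound (k + 2) A A' := by
      unfold corrBound
      rw [sum_Ico_succ_top (by omega : 1 ≤ k + 1)]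
      have : 0 ≤ ∑ D ∈ powersetCard (k + 1) univ,
          chainProb A D * chainProb A' D * momentBound (k + 1) :=
        sum_nonneg fun D _ => mul_nonneg (mul_nonneg (chainProb_nonneg _ _) (chainProb_nonneg _ _))
          (by linarith [two_le_momentBound (k + 1)])
      linarith
    have havg : ((k + 1 : ℝ) ^ 2)⁻¹ * ∑ v ∈ A, ∑ w ∈ A', pairMoment ε k (A.erase v) (A'.erase w) ≤
        corrBound (k + 1) A A' * N := by
      rw [← avg_corrBound k A A' hA hA', mul_assoc]
      refine mul_le_mul_of_nonneg_left ?_ (by positivity)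
      simp only [sum_mul]
      refine sum_le_sum fun v hv => sum_le_sum fun w hw => (ih _ _ ?_ ?_).1
      · rw [card_erase_of_mem hv]; omega
      · rw [card_erase_of_mem hw]; omega
    by_cases hAA' : A = A'
    · subst hAA'
      have h1 : pairMoment ε (k + 1) A A ≤ momentBound (k + 1) * N := by
        rw [pairMoment_succ_self, ← corrBound_self (k + 1) A hA, mul_assoc]
        exact mul_le_mul_of_nonneg_left havg (by norm_num)
      refine ⟨h1.trans (mul_le_mul_of_nonneg_right ?_ hN0), fun _ => h1⟩
      unfold corrBound
      rw [sum_Ico_succ_top (by omega : 1 ≤ k + 1)]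
      have hpos : ∀ j, ∀ D : Finset V, 0 ≤ chainProb A D * chainProb A D * momentBound j :=
        fun j D => mul_nonneg (mul_nonneg (chainProb_nonneg _ _) (chainProb_nonneg _ _))
          (by linarith [two_le_momentBound j])
      have h2 : momentBound (k + 1) ≤ ∑ D ∈ powersetCard (k + 1) univ,
          chainProb A D * chainProb A D * momentBound (k + 1) := by
        have h3 := single_le_sum (f := fun D => chainProb A D * chainProb A D * momentBound (k + 1))
          (fun D _ => hpos (k + 1) D)
          (mem_powersetCard.2 ⟨subset_univ A, hA⟩)
        simpa [chainProb] using h3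
      have h4 : 0 ≤ ∑ j ∈ Ico 1 (k + 1), ∑ D ∈ powersetCard j univ,
          chainProb A D * chainProb A D * momentBound j :=
        sum_nonneg fun j _ => sum_nonneg fun D _ => hpos j D
      linarith
    · refine ⟨?_, fun h => absurd h hAA'⟩
      rw [pairMoment_succ_of_ne ε k hAA' (by omega)]
      exact havg.trans (mul_le_mul_of_nonneg_right hmono hN0)

open Classical in
lemma card_orderWeight_ne_zero (ε : ZMod 2) (k : ℕ) (A : Finset V) (hA : A.card = k) :
    (Fintype.card (Sym2 V → ZMod 2) : ℝ) / momentBound k ≤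
      (univ.filter fun M => orderWeight ε M k A ≠ 0).card := by
  set N := (Fintype.card (Sym2 V → ZMod 2) : ℝ) with hN
  have hN0 : 0 < N := by
    rw [hN]; exact_mod_cast Fintype.card_pos
  set E := univ.filter fun M => orderWeight ε M k A ≠ 0 with hE
  have h1 : ∑ M ∈ E, orderWeight ε M k A = N := by
    rw [hE, sum_filter_ne_zero, sum_orderWeight ε k A hA]
  have h2 : ∑ M ∈ E, orderWeight ε M k A ^ 2 ≤ momentBound k * N := by
    refine le_trans (sum_le_univ_sum_of_nonneg fun M => sq_nonneg _) ?_
    have := (pairMoment_le ε k A A hA hA).2 rfl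
    simpa only [pairMoment, sq] using this
  have h3 := sq_sum_le_card_mul_sum_sq (s := E) (f := fun M => orderWeight ε M k A)
  rw [h1] at h3
  have h4 : N ^ 2 ≤ E.card * (momentBound k * N) :=
    h3.trans (mul_le_mul_of_nonneg_left h2 (by positivity))
  have h5 := two_le_momentBound k
  rw [div_le_iff₀ (by linarith)]
  nlinarith

-- The form on `A` has a single value, so success with `ε = 0` and with `ε = 1` are disjoint events,
-- each of probability at least `1 / b` for `b = momentBound k`. Finally `1 - 2 / b ≤ b / 2 - 1` as
-- `b ≥ 2`, and the right side is the sum in the recursion for `b`.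
open Classical in
lemma card_fail_le_sum (k : ℕ) (hk : 1 ≤ k) (A : Finset V) (hA : A.card = k) :
    ((univ.filter fun M : Sym2 V → ZMod 2 => Fail M A).card : ℝ) ≤
      (∑ j ∈ Ico 1 k, momentBound j / (k.choose j : ℕ)) * Fintype.card (Sym2 V → ZMod 2) := by
  set N := (Fintype.card (Sym2 V → ZMod 2) : ℝ) with hN
  have hN0 : 0 ≤ N := by positivity
  obtain ⟨k, rfl⟩ : ∃ j, k = j + 1 := ⟨k - 1, by omega⟩
  set E := fun ε : ZMod 2 => univ.filter fun M => orderWeight ε M (k + 1) A ≠ 0 with hE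
  set F := univ.filter fun M : Sym2 V → ZMod 2 => Fail M A with hF
  have hq : ∀ ε, ∀ M ∈ E ε, quad M A = ε := by
    intro ε M hM
    by_contra h
    simp [hE, orderWeight, h] at hM
  have h01 : Disjoint (E 0) (E 1) := by
    rw [disjoint_left]
    intro M h0 h1
    exact absurd ((hq 0 M h0).symm.trans (hq 1 M h1)) (by decide)
  have hEF : Disjoint (E 0 ∪ E 1) F := by
    rw [disjoint_left]
    intro M hM hMF
    have : ∀ ε, M ∉ E ε := by
      intro ε h
      obtain ⟨S', h1, h2⟩ := exists_reach_of_orderWeight (k + 1) A hA (mem_filter.1 h).2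
      exact (mem_filter.1 hMF).2 S' h1 h2
    rcases mem_union.1 hM with h | h <;> exact this _ h
  have hcard : ((E 0).card + (E 1).card + F.card : ℝ) ≤ N := by
    rw [hN, ← Nat.cast_add, ← Nat.cast_add, ← card_union_of_disjoint h01,
      ← card_union_of_disjoint hEF]
    exact_mod_cast card_le_univ _
  have h0 := card_orderWeight_ne_zero 0 (k + 1) A hA
  have h1 := card_orderWeight_ne_zero 1 (k + 1) A hA
  have hb := two_le_momentBound (k + 1)
  have hs := momentBound_eq (k + 1)
  set b := momentBound (k + 1) with hbdef
  have h2 : (F.card : ℝ) ≤ N - 2 * (N / b) := by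
    simp only [hE, hN] at *
    linarith
  have h3 : ∑ j ∈ Ico 1 (k + 1), momentBound j / ((k + 1).choose j : ℕ) = b / 2 - 1 := by linarith
  rw [h3]
  refine h2.trans ?_
  have h4 : N - 2 * (N / b) = (1 - 2 / b) * N := by ring
  rw [h4]
  refine mul_le_mul_of_nonneg_right ?_ hN0
  have h5 : 1 - 2 / b = (b - 2) / b := by field_simp
  rw [h5, div_le_iff₀ (by linarith)]
  nlinarith

end

/-! ### Inverse binomial sums and the polynomial bound -/

section

lemma choose_two_le_choose {m j : ℕ} (h2 : 2 ≤ j) (hj : j + 2 ≤ m) : m.choose 2 ≤ m.choose j := by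
  have key : ∀ i, 2 ≤ i → i ≤ m / 2 → m.choose 2 ≤ m.choose i := by
    intro i hi
    induction i, hi using Nat.le_induction with
    | base => intro _; exact le_rfl
    | succ i _ ih =>
      intro h
      exact (ih (by omega)).trans (Nat.choose_le_succ_of_lt_half_left (by omega))
  rcases Nat.lt_or_ge (m / 2) j with h | h
  · rw [← Nat.choose_symm (by omega : j ≤ m)]
    exact key (m - j) (by omega) (by omega)
  · exact key j h2 h

/-- For `m ≥ 4` the two end terms are `1 / m` each, and the `m - 3` inner ones are at most `1 /
m.choose 2`, in total at most `2 / m`. -/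
lemma sum_inv_choose_le {m : ℕ} (hm : 1 ≤ m) :
    ∑ j ∈ Ico 1 m, ((m.choose j : ℕ) : ℝ)⁻¹ ≤ 4 / m := by
  rcases Nat.lt_or_ge m 4 with h | h
  · interval_cases m
    · simp
    · norm_num [sum_Ico_succ_top]
    · norm_num [sum_Ico_succ_top, Nat.choose]
  obtain ⟨k, rfl⟩ : ∃ k, m = k + 2 := ⟨m - 2, by omega⟩
  have h1 : ∀ j ∈ Ico 2 (k + 1), (((k + 2).choose j : ℕ) : ℝ)⁻¹ ≤ (((k + 2).choose 2 : ℕ) : ℝ)⁻¹ := by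
    intro j hj
    rw [mem_Ico] at hj
    refine inv_anti₀ (by exact_mod_cast Nat.choose_pos (by omega)) ?_
    exact_mod_cast choose_two_le_choose hj.1 (by omega)
  rw [sum_Ico_succ_top (by omega), sum_eq_sum_Ico_succ_bot (by omega)]
  have h2 := sum_le_sum h1
  rw [sum_const, Nat.card_Ico, nsmul_eq_mul] at h2
  have h3 : (((k + 2).choose 2 : ℕ) : ℝ) = (k + 2) * (k + 1) / 2 := by
    rw [Nat.cast_choose_two]; push_cast; ring
  have h4 : ((k + 1 - 2 : ℕ) : ℝ) = k - 1 := by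
    rw [Nat.cast_sub (by omega)]; push_cast; ring
  rw [h3, h4] at h2
  have h5 : (k + 2).choose (k + 1) = k + 2 := Nat.choose_succ_self_right (k + 1)
  rw [h5, Nat.choose_one_right]
  have h6 : ((k : ℝ) - 1) * (((k : ℝ) + 2) * (k + 1) / 2)⁻¹ ≤ 2 / (k + 2) := by
    rw [inv_div, ← mul_div_assoc, div_le_div_iff₀ (by positivity) (by positivity)]
    nlinarith
  have h7 : (4 : ℝ) / ((k + 2 : ℕ) : ℝ) = ((k + 2 : ℕ) : ℝ)⁻¹ + 2 / (k + 2) + ((k + 2 : ℕ) : ℝ)⁻¹ := by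
    push_cast; field_simp; norm_num
  rw [h7]
  simp only [Nat.reduceAdd] at *
  linarith

lemma momentBound_bounded : ∃ B : ℝ, 0 < B ∧ ∀ k, momentBound k ≤ B := by
  have h0 : ∀ k, 0 ≤ momentBound k := fun k => by linarith [two_le_momentBound k]
  -- For `k ≥ 16` the inverse binomials sum to at most `1/4`, so the recursion gives at most `2 * (1
  -- + B / 4) ≤ B` when `B ≥ 4`; the finite sum handles the smaller `k`.
  refine ⟨4 + ∑ k ∈ range 16, momentBound k, by
    linarith [sum_nonneg fun k (_ : k ∈ range 16) => h0 k], fun k => ?_⟩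
  set B := 4 + ∑ k ∈ range 16, momentBound k with hB
  have hB4 : 4 ≤ B := by linarith [sum_nonneg fun k (_ : k ∈ range 16) => h0 k]
  induction k using Nat.strong_induction_on with
  | _ k ih =>
    rcases Nat.lt_or_ge k 16 with h | h
    · have := single_le_sum (f := momentBound) (fun i _ => h0 i) (mem_range.2 h)
      linarith
    · rw [momentBound_eq]
      have h1 : ∑ j ∈ Ico 1 k, momentBound j / (k.choose j : ℕ) ≤ B * (4 / k) := by
        refine le_trans ?_ (mul_le_mul_of_nonneg_left (sum_inv_choose_le (by omega : 1 ≤ k))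
          (by linarith))
        rw [mul_sum]
        refine sum_le_sum fun j hj => ?_
        rw [div_eq_mul_inv]
        exact mul_le_mul_of_nonneg_right (ih j (mem_Ico.1 hj).2) (by positivity)
      have h2 : (4 : ℝ) / k ≤ 1 / 4 := by
        have : (16 : ℝ) ≤ k := by exact_mod_cast h
        rw [div_le_div_iff₀ (by linarith) (by norm_num)]; linarith
      nlinarith

open Classical in
/-- The number of matrices for which peeling `S` fails. -/
noncomputable def failCount {V : Type*} [DecidableEq V] [Fintype V] (S : Finset V) : ℝ :=
  (univ.filter fun M : Sym2 V → ZMod 2 => Fail M S).card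

/-- The second moment method: peeling fails with probability `O(1 / m)`. -/
theorem exists_failCount_le_div : ∃ C : ℝ, 0 < C ∧ ∀ (V : Type) [DecidableEq V] [Fintype V]
    (S : Finset V), 1 ≤ S.card →
      failCount S ≤ C / S.card * Fintype.card (Sym2 V → ZMod 2) := by
  obtain ⟨B, hB0, hB⟩ := momentBound_bounded
  refine ⟨4 * B, by linarith, fun V _ _ S hS => ?_⟩
  refine (card_fail_le_sum S.card hS S rfl).trans (mul_le_mul_of_nonneg_right ?_ (by positivity))
  have h1 := mul_le_mul_of_nonneg_left (sum_inv_choose_le hS) hB0.le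
  rw [mul_sum] at h1
  refine le_trans (sum_le_sum fun j _ => ?_) (h1.trans (by ring_nf; exact le_rfl))
  rw [div_eq_mul_inv]
  exact mul_le_mul_of_nonneg_right (hB j) (by positivity)

end

/-! ### Splitting a vertex set into two halves -/

section

variable {V : Type*} [DecidableEq V]

/-- Starting from `S`, none of the first `i` tails of the list `P` is reachable. -/
def NoHit (M : Sym2 V → ZMod 2) (S : Finset V) (P : List V) (i : ℕ) : Prop :=
  ∀ k < i, ¬ Reach M S (P.drop k).toFinset

/-- Take the first reachable tail, if there is one early enough: failure is inherited by every
reachable set. -/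
lemma Fail.cases {M : Sym2 V → ZMod 2} {S : Finset V} (hF : Fail M S) (P : List V) (t : ℕ) :
    (∃ i ∈ range (t + 1), NoHit M S P i ∧ Fail M (P.drop i).toFinset) ∨ NoHit M S P (t + 1) := by
  classical
  by_cases h : NoHit M S P (t + 1)
  · exact .inr h
  · left
    have h' : ∃ k, Reach M S (P.drop k).toFinset := by
      simp only [NoHit, not_forall, not_not] at h
      obtain ⟨k, _, hk⟩ := h
      exact ⟨k, hk⟩
    refine ⟨Nat.find h', ?_, fun k hk => Nat.find_min h' hk, hF.of_reach (Nat.find_spec h')⟩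
    rw [mem_range]
    by_contra hlt
    exact h fun k hk => Nat.find_min h' (by omega)

lemma NoHit.not_hit {M : Sym2 V → ZMod 2} {P Q : List V} {i : ℕ}
    (h : NoHit M (P.toFinset ∪ Q.toFinset) P (i + 1)) :
    ¬ Hit M Q.toFinset (P.take i) (P.drop i).toFinset := by
  rintro ⟨ps', ⟨l, hl⟩, hR⟩
  have hlen : l.length ≤ i := by
    have := congrArg List.length hl
    simp only [List.length_append, List.length_take] at this
    omega
  refine h l.length (by omega) ?_
  have h1 : P.drop l.length = ps' ++ P.drop i := by
    conv_lhs => rw [← List.take_append_drop i P, ← hl, List.append_assoc, List.drop_left]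
  have h2 : Q.toFinset ∪ (P.take i).toFinset ∪ (P.drop i).toFinset = P.toFinset ∪ Q.toFinset := by
    rw [union_assoc, ← List.toFinset_append, List.take_append_drop, union_comm]
  rw [h1, List.toFinset_append]
  rw [h2] at hR
  exact hR

lemma potential_le (h : ℕ) : potential h ≤ 4 + h := by
  unfold potential
  have : (0 : ℝ) ≤ 4 * 0 ^ h := by positivity
  linarith

variable [Fintype V]

open Classical in
/-- The event `NoHit` is exponentially unlikely, conditionally on the entries indexed by `Q` and
by the tail of `P`. -/
lemma sum_noHit_le {P Q : List V} (hP : P.Nodup) (hPQ : P.Disjoint Q) {i : ℕ} (hi : i < P.length)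
    (φ : (Sym2 V → ZMod 2) → ℝ) (hφ0 : ∀ M, 0 ≤ φ M)
    (hφ : ∀ M N : Sym2 V → ZMod 2, (∀ x ∈ Q, ∀ y ∈ Q, M s(x, y) = N s(x, y)) →
      (∀ x ∈ P.drop (i + 1), ∀ y ∈ P.drop (i + 1), M s(x, y) = N s(x, y)) → φ M = φ N) :
    ∑ M, (if NoHit M (P.toFinset ∪ Q.toFinset) P (i + 1) then φ M else 0) ≤
      (Q.toFinset.card + 4 : ℝ) * (79 / 80 : ℝ) ^ (4 * (i + 1)) * ∑ M, φ M := by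
  have hdrop : P.drop i = P[i] :: P.drop (i + 1) := List.drop_eq_getElem_cons hi
  have hnd : (P.take i ++ P.drop i).Nodup := by rwa [List.take_append_drop]
  have hdisj := List.nodup_append'.1 hnd
  have hbB : P[i] ∈ (P.drop i).toFinset :=
    List.mem_toFinset.2 (hdrop.symm ▸ List.mem_cons_self)
  have hPi : P[i] ∉ P.drop (i + 1) := by
    have := hdisj.2.1
    rw [hdrop, List.nodup_cons] at this
    exact this.1
  -- `P[i]` plays the role of the reference vertex `b`. Its row is translated, so `φ` may depend on
  -- the tail only from index `i + 1` on, which is exactly the tail paired with `NoHit` at `i + 1`.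
  have hmain := sum_not_hit_le hbB (P.take i) hdisj.1
    (fun p hp => by rw [List.mem_toFinset]; exact fun h => hdisj.2.2 hp h)
    Q.toFinset Q.toFinset subset_rfl
    (fun p hp => by rw [List.mem_toFinset]; exact fun h => hPQ (List.mem_of_mem_take hp) h)
    (by
      rw [disjoint_left]
      intro x hx hx'
      rw [List.mem_toFinset] at hx hx'
      exact hPQ (List.mem_of_mem_drop hx') hx) φ hφ0
    (by
      intro p hp C' hC' hpC' hbC' ρ M
      have hpQ : ∀ x ∈ Q, x ≠ p ∧ x ≠ P[i] := fun x hx =>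
        ⟨fun e => hPQ (List.mem_of_mem_take hp) (e ▸ hx),
          fun e => hPQ (List.getElem_mem hi) (e ▸ hx)⟩
      have hpD : ∀ x ∈ P.drop (i + 1), x ≠ p ∧ x ≠ P[i] := fun x hx =>
        ⟨fun e => hdisj.2.2 hp (e ▸ hdrop.symm ▸ List.mem_cons_of_mem _ hx), fun e => hPi (e ▸ hx)⟩
      refine hφ _ _ (fun x hx y hy => ?_) fun x hx y hy => ?_
      · rw [Pi.add_apply, rowShift_eq_zero (hpQ x hx).1 (hpQ x hx).2 (hpQ y hy).1 (hpQ y hy).2,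
          add_zero]
      · rw [Pi.add_apply, rowShift_eq_zero (hpD x hx).1 (hpD x hx).2 (hpD y hy).1 (hpD y hy).2,
          add_zero])
  calc ∑ M, (if NoHit M (P.toFinset ∪ Q.toFinset) P (i + 1) then φ M else 0)
      ≤ ∑ M, (if Hit M Q.toFinset (P.take i) (P.drop i).toFinset then 0 else φ M) := by
        refine sum_le_sum fun M _ => ?_
        by_cases h : NoHit M (P.toFinset ∪ Q.toFinset) P (i + 1)
        · rw [if_pos h, if_neg h.not_hit]
        · rw [if_neg h]; split_ifs <;> simp [hφ0]
    _ ≤ _ := hmain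
    _ ≤ _ := by
        refine mul_le_mul_of_nonneg_right ?_ (sum_nonneg fun M _ => hφ0 M)
        rw [List.length_take, min_eq_left hi.le, mul_add, pow_add, mul_one, ← pow_mul]
        have h1 := potential_le Q.toFinset.card
        have h2 : (0 : ℝ) ≤ (79 / 80) ^ (4 * i) := by positivity
        -- The factor `1/5` from the potential pays for raising the exponent from `i` to `i + 1`.
        have h3 : (1 / 5 : ℝ) ≤ (79 / 80) ^ 4 := by norm_num
        have h4 : (0 : ℝ) ≤ 4 + Q.toFinset.card := by positivity
        calc (79 / 80 : ℝ) ^ (4 * i) * potential Q.toFinset.card / 5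
            ≤ (79 / 80 : ℝ) ^ (4 * i) * (4 + Q.toFinset.card) * (1 / 5) := by
              rw [div_eq_mul_one_div]
              exact mul_le_mul_of_nonneg_right (mul_le_mul_of_nonneg_left h1 h2) (by norm_num)
          _ ≤ (79 / 80 : ℝ) ^ (4 * i) * (4 + Q.toFinset.card) * (79 / 80) ^ 4 :=
              mul_le_mul_of_nonneg_left h3 (by positivity)
          _ = _ := by ring

open Classical in
/-- Failure on disjoint sets is independent. -/
lemma card_fail_and_fail_le {X Y : Finset V} (hXY : Disjoint X Y) :
    ((univ.filter fun M : Sym2 V → ZMod 2 => Fail M X ∧ Fail M Y).card : ℝ) *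
      Fintype.card (Sym2 V → ZMod 2) ≤ failCount X * failCount Y := by
  unfold failCount
  rw [← card_univ]
  norm_cast
  rw [← card_product, ← card_product]
  -- Exchange the entries inside `X` between `M`, failing on both sets, and an arbitrary `N`: one
  -- result inherits failure on `X`, the other failure on `Y`.
  let mix : (Sym2 V → ZMod 2) → (Sym2 V → ZMod 2) → Sym2 V → ZMod 2 :=
    fun M N z => if z ∈ X.sym2 then M z else N z
  refine card_le_card_of_injOn (fun MN => (mix MN.1 MN.2, mix MN.2 MN.1)) ?_ ?_
  · rintro ⟨M, N⟩ hMN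
    simp only [coe_product, coe_filter, mem_univ, true_and, Set.mem_prod, Set.mem_ofPred_eq,
      coe_univ, Set.mem_univ, and_true] at hMN ⊢
    refine ⟨(fail_congr fun x hx y hy => ?_).1 hMN.1, (fail_congr fun x hx y hy => ?_).1 hMN.2⟩
    · simp [mix, hx, hy]
    · have : x ∉ X := fun h => disjoint_left.1 hXY h hx
      simp [mix, this]
  · rintro ⟨M, N⟩ - ⟨M', N'⟩ - h
    simp only [Prod.mk.injEq, funext_iff] at h
    simp only [Prod.mk.injEq, funext_iff]
    refine ⟨fun z => ?_, fun z => ?_⟩ <;> by_cases hz : z ∈ X.sym2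
    · simpa only [mix, if_pos hz] using h.1 z
    · simpa only [mix, if_neg hz] using h.2 z
    · simpa only [mix, if_pos hz] using h.2 z
    · simpa only [mix, if_neg hz] using h.1 z

open Classical in
lemma card_noHit_and_fail_le {P Q : List V} (hP : P.Nodup) (hPQ : P.Disjoint Q) {i j : ℕ}
    (hi : i ≤ P.length) :
    ((univ.filter fun M : Sym2 V → ZMod 2 => NoHit M (P.toFinset ∪ Q.toFinset) P i ∧
      Fail M (P.drop i).toFinset ∧ Fail M (Q.drop j).toFinset).card : ℝ) ≤
      (Q.toFinset.card + 4 : ℝ) * (79 / 80 : ℝ) ^ (4 * i) *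
      (univ.filter fun M : Sym2 V → ZMod 2 =>
        Fail M (P.drop i).toFinset ∧ Fail M (Q.drop j).toFinset).card := by
  rcases i with _ | i
  · rw [mul_zero, pow_zero, mul_one]
    refine le_trans (Nat.cast_le.2 (card_le_card fun M hM => ?_))
      (le_mul_of_one_le_left (Nat.cast_nonneg _) (by linarith [Q.toFinset.card.cast_nonneg (α := ℝ)]))
    rw [mem_filter] at hM ⊢
    exact ⟨hM.1, hM.2.2⟩
  · have := sum_noHit_le hP hPQ hi
      (fun M => if Fail M (P.drop (i + 1)).toFinset ∧ Fail M (Q.drop j).toFinset then (1 : ℝ) else 0)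
      (fun M => by positivity) (fun M N h1 h2 => by
        have e1 : Fail M (P.drop (i + 1)).toFinset ↔ Fail N (P.drop (i + 1)).toFinset :=
          fail_congr fun x hx y hy => h2 x (List.mem_toFinset.1 hx) y (List.mem_toFinset.1 hy)
        have e2 : Fail M (Q.drop j).toFinset ↔ Fail N (Q.drop j).toFinset :=
          fail_congr fun x hx y hy => h1 x (List.mem_of_mem_drop (List.mem_toFinset.1 hx)) y
            (List.mem_of_mem_drop (List.mem_toFinset.1 hy))
        simp only [e1, e2])
    simpa only [← ite_and, sum_boole] using this

open Classical in
lemma card_noHit_le {P Q : List V} (hP : P.Nodup) (hPQ : P.Disjoint Q) {i : ℕ}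
    (hi : i < P.length) :
    ((univ.filter fun M : Sym2 V → ZMod 2 =>
      NoHit M (P.toFinset ∪ Q.toFinset) P (i + 1)).card : ℝ) ≤
      (Q.toFinset.card + 4 : ℝ) * (79 / 80 : ℝ) ^ (4 * (i + 1)) *
        Fintype.card (Sym2 V → ZMod 2) := by
  have := sum_noHit_le hP hPQ hi (fun _ => (1 : ℝ)) (fun _ => zero_le_one) fun _ _ _ _ => rfl
  simpa only [sum_boole, sum_const, card_univ, nsmul_eq_mul, mul_one] using this

/-- Two geometric means combine the three bounds. The two `NoHit` events are not shown to be
independent, so only one decay can be used at a time; carrying fourth powers lets a first power of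
both survive. -/
lemma le_sqrt_mul_of_le {x K a b g : ℝ} (hx : 0 ≤ x) (hK : 0 ≤ K) (ha : 0 ≤ a) (hb : 0 ≤ b)
    (hg : 0 ≤ g) (h : x ≤ g) (h1 : x ≤ K * a ^ 4 * g) (h2 : x ≤ K * b ^ 4 * g) :
    x ≤ √K * (a * b * g) := by
  have h3 : x ≤ K * (a * b) ^ 2 * g := by
    refine le_of_sq_le_sq ?_ (by positivity)
    calc x ^ 2 = x * x := sq x
      _ ≤ (K * a ^ 4 * g) * (K * b ^ 4 * g) := mul_le_mul h1 h2 hx (by positivity)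
      _ = _ := by ring
  refine le_of_sq_le_sq ?_ (by positivity)
  calc x ^ 2 = x * x := sq x
    _ ≤ (K * (a * b) ^ 2 * g) * g := mul_le_mul h3 h hx (by positivity)
    _ = _ := by rw [mul_pow √K, Real.sq_sqrt hK]; ring

/-- Splitting a vertex set into two parts bounds the failure probability by a product. -/
theorem failCount_union_le {P Q : List V} (hP : P.Nodup) (hQ : Q.Nodup) (hPQ : P.Disjoint Q)
    {t : ℕ} (htP : t < P.length) (htQ : t < Q.length) {γ : ℕ → ℝ}
    (hγ : ∀ X : Finset V, X.Nonempty → X.card < P.length + Q.length →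
      failCount X ≤ γ X.card * Fintype.card (Sym2 V → ZMod 2)) :
    failCount (P.toFinset ∪ Q.toFinset) ≤
      (√(P.length + Q.length + 4) *
        ((∑ i ∈ range (t + 1), (79 / 80) ^ i * γ (P.length - i)) *
          ∑ j ∈ range (t + 1), (79 / 80) ^ j * γ (Q.length - j)) +
        2 * ((P.length + Q.length + 4) * (79 / 80) ^ (4 * (t + 1)))) *
      Fintype.card (Sym2 V → ZMod 2) := by
  classical
  set N : ℝ := (Fintype.card (Sym2 V → ZMod 2) : ℝ) with hN
  have hN0 : 0 < N := by rw [hN]; exact_mod_cast Fintype.card_pos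
  set S := P.toFinset ∪ Q.toFinset with hS
  have hcP : P.toFinset.card = P.length := List.toFinset_card_of_nodup hP
  have hcQ : Q.toFinset.card = Q.length := List.toFinset_card_of_nodup hQ
  set K : ℝ := P.length + Q.length + 4 with hK
  have hK0 : 0 ≤ K := by positivity
  have hKP : (P.toFinset.card + 4 : ℝ) ≤ K := by
    rw [hcP, hK]; linarith [Q.length.cast_nonneg (α := ℝ)]
  have hKQ : (Q.toFinset.card + 4 : ℝ) ≤ K := by
    rw [hcQ, hK]; linarith [P.length.cast_nonneg (α := ℝ)]
  let E (i j : ℕ) : Finset (Sym2 V → ZMod 2) := univ.filter fun M =>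
    (NoHit M S P i ∧ Fail M (P.drop i).toFinset) ∧ NoHit M S Q j ∧ Fail M (Q.drop j).toFinset
  have hE : ∀ i ∈ range (t + 1), ∀ j ∈ range (t + 1), ((E i j).card : ℝ) ≤
      √K * ((79 / 80) ^ i * (79 / 80) ^ j *
        (γ (P.length - i) * γ (Q.length - j) * N)) := by
    intro i hi j hj
    rw [mem_range] at hi hj
    set F : ℝ := ((univ.filter fun M : Sym2 V → ZMod 2 =>
      Fail M (P.drop i).toFinset ∧ Fail M (Q.drop j).toFinset).card : ℝ) with hF
    have hcX : (P.drop i).toFinset.card = P.length - i := by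
      rw [List.toFinset_card_of_nodup (hP.sublist (List.drop_sublist i P)), List.length_drop]
    have hcY : (Q.drop j).toFinset.card = Q.length - j := by
      rw [List.toFinset_card_of_nodup (hQ.sublist (List.drop_sublist j Q)), List.length_drop]
    have hX : (P.drop i).toFinset.Nonempty := by rw [← card_pos, hcX]; omega
    have hY : (Q.drop j).toFinset.Nonempty := by rw [← card_pos, hcY]; omega
    have hγX := hγ _ hX (by omega)
    have hγY := hγ _ hY (by omega)
    rw [hcX] at hγX
    rw [hcY] at hγY
    have hdis : Disjoint (P.drop i).toFinset (Q.drop j).toFinset := by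
      rw [disjoint_left]
      intro x hx hx'
      exact hPQ (List.mem_of_mem_drop (List.mem_toFinset.1 hx))
        (List.mem_of_mem_drop (List.mem_toFinset.1 hx'))
    have hfX : 0 ≤ failCount (P.drop i).toFinset := Nat.cast_nonneg _
    have hfY : 0 ≤ failCount (Q.drop j).toFinset := Nat.cast_nonneg _
    have hFle : F ≤ γ (P.length - i) * γ (Q.length - j) * N := by
      refine le_of_mul_le_mul_right ?_ hN0
      refine (card_fail_and_fail_le hdis).trans ?_
      refine (mul_le_mul hγX hγY hfY (hfX.trans hγX)).trans_eq ?_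
      ring
    have hF0 : 0 ≤ F := Nat.cast_nonneg _
    have hEF : ((E i j).card : ℝ) ≤ F := by
      refine Nat.cast_le.2 (card_le_card fun M hM => ?_)
      simp only [E, mem_filter] at hM ⊢
      exact ⟨hM.1, hM.2.1.2, hM.2.2.2⟩
    refine (le_sqrt_mul_of_le (a := (79 / 80) ^ i) (b := (79 / 80) ^ j) (g := F) (Nat.cast_nonneg _) hK0 (by positivity) (by positivity)
      hF0 hEF ?_ ?_).trans ?_
    · have h1 := card_noHit_and_fail_le hP hPQ (i := i) (j := j) (by omega)
      refine le_trans (Nat.cast_le.2 (card_le_card fun M hM => ?_)) (h1.trans ?_)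
      · simp only [E, mem_filter] at hM ⊢
        exact ⟨hM.1, hM.2.1.1, hM.2.1.2, hM.2.2.2⟩
      · rw [← pow_mul, mul_comm i 4]
        gcongr
    · have h1 := card_noHit_and_fail_le hQ hPQ.symm (i := j) (j := i) (by omega)
      refine le_trans (Nat.cast_le.2 (card_le_card fun M hM => ?_)) (h1.trans ?_)
      · simp only [E, mem_filter] at hM ⊢
        rw [union_comm]
        exact ⟨hM.1, hM.2.2.1, hM.2.2.2, hM.2.1.2⟩
      · rw [← pow_mul, mul_comm j 4]
        simp only [and_comm (a := Fail _ (Q.drop j).toFinset)]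
        gcongr
    · gcongr
  let T₁ : Finset (Sym2 V → ZMod 2) := univ.filter fun M => NoHit M S P (t + 1)
  let T₂ : Finset (Sym2 V → ZMod 2) := univ.filter fun M => NoHit M S Q (t + 1)
  have hT₁ : (T₁.card : ℝ) ≤ K * (79 / 80) ^ (4 * (t + 1)) * N := by
    refine (card_noHit_le hP hPQ htP).trans ?_
    gcongr
  have hT₂ : (T₂.card : ℝ) ≤ K * (79 / 80) ^ (4 * (t + 1)) * N := by
    have := card_noHit_le hQ hPQ.symm htQ
    rw [union_comm] at this
    refine this.trans ?_
    gcongr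
  have hcover : (univ.filter fun M : Sym2 V → ZMod 2 => Fail M S) ⊆
      ((range (t + 1)).biUnion fun i => (range (t + 1)).biUnion fun j => E i j) ∪ T₁ ∪ T₂ := by
    intro M hM
    have hM' := (mem_filter.1 hM).2
    rw [mem_union, mem_union]
    rcases hM'.cases P t with ⟨i, hi, h1⟩ | h1
    · rcases hM'.cases Q t with ⟨j, hj, h2⟩ | h2
      · exact .inl (.inl (mem_biUnion.2 ⟨i, hi, mem_biUnion.2 ⟨j, hj,
          mem_filter.2 ⟨mem_univ _, h1, h2⟩⟩⟩))
      · exact .inr (mem_filter.2 ⟨mem_univ _, h2⟩)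
    · exact .inl (.inr (mem_filter.2 ⟨mem_univ _, h1⟩))
  have hcard : failCount S ≤ (∑ i ∈ range (t + 1), ∑ j ∈ range (t + 1), ((E i j).card : ℝ)) +
      T₁.card + T₂.card := by
    have h1 : (univ.filter fun M : Sym2 V → ZMod 2 => Fail M S).card ≤
        (∑ i ∈ range (t + 1), ∑ j ∈ range (t + 1), (E i j).card) + T₁.card + T₂.card := by
      refine (card_le_card hcover).trans ((card_union_le _ _).trans (Nat.add_le_add_right
        ((card_union_le _ _).trans (Nat.add_le_add_right ?_ _)) _))
      exact card_biUnion_le.trans (sum_le_sum fun i _ => card_biUnion_le)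
    unfold failCount
    exact_mod_cast h1
  refine hcard.trans ?_
  have hsum : ∑ i ∈ range (t + 1), ∑ j ∈ range (t + 1), ((E i j).card : ℝ) ≤
      √K * ((∑ i ∈ range (t + 1), (79 / 80) ^ i * γ (P.length - i)) *
          ∑ j ∈ range (t + 1), (79 / 80) ^ j * γ (Q.length - j)) * N := by
    rw [sum_mul_sum, mul_sum, sum_mul]
    refine sum_le_sum fun i hi => ?_
    rw [mul_sum, sum_mul]
    refine sum_le_sum fun j hj => (hE i hi j hj).trans_eq ?_
    ring
  linarith

end

/-! ### Induction from a polynomial to an exponential bound -/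

section

lemma eventually_sqrt_mul_le (A : ℝ) : ∀ᶠ n : ℕ in Filter.atTop, √(n + 4) * A ≤ n := by
  filter_upwards [Filter.eventually_ge_atTop 4,
    (tendsto_natCast_atTop_atTop (R := ℝ)).eventually_ge_atTop (2 * A ^ 2)] with n h4 hA
  have h4' : (4 : ℝ) ≤ n := by exact_mod_cast h4
  refine le_of_sq_le_sq ?_ (by positivity)
  rw [mul_pow, Real.sq_sqrt (by positivity)]
  nlinarith [sq_nonneg A]

lemma eventually_mul_pow_le {q D : ℝ} (hq0 : 0 ≤ q) (hq : q < 1) (hD : 0 < D) :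
    ∀ᶠ n : ℕ in Filter.atTop, 4 * n * (n + 4) * q ^ n ≤ D := by
  have h := tendsto_pow_const_mul_const_pow_of_abs_lt_one 2 (abs_lt.2 ⟨by linarith, hq⟩)
  filter_upwards [h.eventually_le_const (by positivity : 0 < D / 20),
    Filter.eventually_ge_atTop 1] with n hn h1
  have h1' : (1 : ℝ) ≤ n := by exact_mod_cast h1
  calc 4 * n * (n + 4) * q ^ n ≤ 20 * n ^ 2 * q ^ n := by
        refine mul_le_mul_of_nonneg_right ?_ (by positivity)
        nlinarith
    _ = 20 * (n ^ 2 * q ^ n) := by ring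
    _ ≤ 20 * (D / 20) := mul_le_mul_of_nonneg_left hn (by norm_num)
    _ = D := by ring

/-- Shortening the tail by `i` loses `exp c ^ i`, which the decay absorbs. The constant is `1280 = 8
* 160`: the `8` bounds `m / (s - i)`, and `160` bounds the geometric series of ratio `159 / 160`. -/
lemma sum_pow_mul_exp_le {c D : ℝ} (hD : 0 ≤ D) (hc : Real.exp c * (79 / 80) ≤ 159 / 160)
    {m s t : ℕ} (hm : 0 < m) (hts : t < s) (hs : m ≤ 8 * (s - t)) :
    ∑ i ∈ range (t + 1), (79 / 80 : ℝ) ^ i * (D * Real.exp (-(c * (s - i : ℕ))) / (s - i : ℕ)) ≤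
      1280 * D * Real.exp (-(c * s)) / m := by
  have hm' : (0 : ℝ) < m := by exact_mod_cast hm
  calc ∑ i ∈ range (t + 1), (79 / 80 : ℝ) ^ i *
        (D * Real.exp (-(c * (s - i : ℕ))) / (s - i : ℕ))
      ≤ ∑ i ∈ range (t + 1), (8 * D * Real.exp (-(c * s)) / m) * (159 / 160) ^ i := by
        refine sum_le_sum fun i hi => ?_
        have hi' : i ≤ t := by have := mem_range.1 hi; omega
        have h1 : (0 : ℝ) < ((s - i : ℕ) : ℝ) := by
          have : 0 < s - i := by omega
          exact_mod_cast this
        have h2 : (m : ℝ) ≤ 8 * ((s - i : ℕ) : ℝ) := by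
          have : m ≤ 8 * (s - i) := by omega
          exact_mod_cast this
        have h3 : Real.exp (-(c * (s - i : ℕ))) = Real.exp (-(c * s)) * Real.exp c ^ i := by
          rw [← Real.exp_nat_mul, ← Real.exp_add, Nat.cast_sub (by omega)]
          congr 1; ring
        have h4 : (1 : ℝ) / ((s - i : ℕ) : ℝ) ≤ 8 / m := by
          rw [div_le_div_iff₀ h1 hm']; linarith
        calc (79 / 80 : ℝ) ^ i * (D * Real.exp (-(c * (s - i : ℕ))) / (s - i : ℕ))
            = D * Real.exp (-(c * s)) * (1 / ((s - i : ℕ) : ℝ)) *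
                (Real.exp c * (79 / 80)) ^ i := by rw [h3, mul_pow]; ring
          _ ≤ D * Real.exp (-(c * s)) * (8 / m) * (159 / 160) ^ i := by gcongr
          _ = _ := by ring
    _ ≤ (8 * D * Real.exp (-(c * s)) / m) * 160 := by
        rw [← mul_sum]
        refine mul_le_mul_of_nonneg_left ?_ (by positivity)
        have := geom_sum_eq (by norm_num : (159 / 160 : ℝ) ≠ 1) (t + 1)
        rw [this]
        have h0 : (0 : ℝ) ≤ (159 / 160) ^ (t + 1) := by positivity
        rw [div_le_iff_of_neg (by norm_num)]; linarith
    _ = _ := by ring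

/-- Peeling fails with exponentially small probability. -/
theorem exists_failCount_le_exp : ∃ c D : ℝ, 0 < c ∧ 0 < D ∧
    ∀ (V : Type) [DecidableEq V] [Fintype V] (S : Finset V), 1 ≤ S.card →
      failCount S ≤ D * Real.exp (-(c * S.card)) / S.card *
        (Fintype.card (Sym2 V → ZMod 2) : ℝ) := by
  obtain ⟨C, hC0, hC⟩ := exists_failCount_le_div
  obtain ⟨m₀, hm₀⟩ := Filter.eventually_atTop.1
    ((eventually_sqrt_mul_le (2 * 1280 ^ 2 * (2 * C))).and
    (eventually_mul_pow_le (q := 159 / 160) (D := 2 * C) (by norm_num) (by norm_num)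
      (by positivity)))
  set m₁ : ℕ := max m₀ 4 with hm₁
  have hm₁0 : (0 : ℝ) < m₁ := by
    have : 0 < m₁ := by omega
    exact_mod_cast this
  -- The first condition keeps `exp (-c n) ≥ 1/2` below `m₁`, so the polynomial bound with doubled
  -- constant gives the base case; the second leaves a decay of `159 / 160` for the inductive step.
  obtain ⟨c, hc0, hcm, hcq⟩ : ∃ c : ℝ, 0 < c ∧ c * m₁ ≤ Real.log 2 ∧
      Real.exp c * (79 / 80) ≤ 159 / 160 := by
    refine ⟨min (Real.log 2 / m₁) (Real.log (159 / 158)), lt_min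
      (div_pos (Real.log_pos (by norm_num)) hm₁0) (Real.log_pos (by norm_num)), ?_, ?_⟩
    · exact (mul_le_mul_of_nonneg_right (min_le_left _ _) hm₁0.le).trans_eq
        (div_mul_cancel₀ _ hm₁0.ne')
    · have := (Real.exp_le_exp.2 (min_le_right (Real.log 2 / m₁) (Real.log (159 / 158)))).trans_eq
        (Real.exp_log (by norm_num))
      linarith
  refine ⟨c, 2 * C, hc0, by positivity, fun V _ _ S hS => ?_⟩
  induction hn : S.card using Nat.strong_induction_on generalizing S with
  | _ n ih =>
    have hn1 : 1 ≤ n := hn ▸ hS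
    have hn0 : (0 : ℝ) < n := by exact_mod_cast hn1
    rcases Nat.lt_or_ge n m₁ with hlt | hge
    · refine (hC V S hS).trans (mul_le_mul_of_nonneg_right ?_ (Nat.cast_nonneg _))
      rw [hn]
      refine div_le_div_of_nonneg_right ?_ hn0.le
      have h1 : c * n ≤ Real.log 2 :=
        (mul_le_mul_of_nonneg_left (by exact_mod_cast hlt.le) hc0.le).trans hcm
      have h2 : (1 / 2 : ℝ) ≤ Real.exp (-(c * n)) := by
        rw [← Real.log_le_iff_le_exp (by norm_num), one_div, Real.log_inv]
        linarith
      nlinarith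
    · obtain ⟨hsqrt, hpow⟩ := hm₀ n (by omega)
      have hn4 : 4 ≤ n := by omega
      set P := S.toList.take (n / 2) with hP
      set Q := S.toList.drop (n / 2) with hQ
      have hPQ : P ++ Q = S.toList := List.take_append_drop _ _
      have hlP : P.length = n / 2 := by
        rw [hP, List.length_take, length_toList, hn]; omega
      have hlQ : Q.length = n - n / 2 := by
        rw [hQ, List.length_drop, length_toList, hn]
      have hnd : (P ++ Q).Nodup := hPQ ▸ S.nodup_toList
      obtain ⟨hP', hQ', hdis⟩ := List.nodup_append'.1 hnd
      have hS' : P.toFinset ∪ Q.toFinset = S := by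
        rw [← List.toFinset_append, hPQ, toList_toFinset]
      have hlen : P.length + Q.length = n := by omega
      have hlenR : (P.length : ℝ) + Q.length = n := by exact_mod_cast hlen
      -- With `t = n / 4` all tails have size at least `n / 8`, while `4 * (t + 1) ≥ n` makes the
      -- error term decay like `(79 / 80) ^ n`.
      have key := failCount_union_le hP' hQ' hdis (t := n / 4) (by omega) (by omega)
        (γ := fun k => 2 * C * Real.exp (-(c * k)) / k)
        (fun X hX hlt => ih X.card (by omega) X (card_pos.2 hX) rfl)
      rw [hS', hlenR] at key
      refine key.trans (mul_le_mul_of_nonneg_right ?_ (Nat.cast_nonneg _))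
      have hA := sum_pow_mul_exp_le (D := 2 * C) (by positivity) hcq (m := n) (s := P.length)
        (t := n / 4) (by omega) (by omega) (by omega)
      have hB := sum_pow_mul_exp_le (D := 2 * C) (by positivity) hcq (m := n) (s := Q.length)
        (t := n / 4) (by omega) (by omega) (by omega)
      have hexp : Real.exp (-(c * P.length)) * Real.exp (-(c * Q.length)) =
          Real.exp (-(c * n)) := by
        rw [← Real.exp_add, ← hlenR]; congr 1; ring
      set x := Real.exp (-(c * n)) with hx
      have hx0 : 0 < x := Real.exp_pos _
      have h1 : √(n + 4) * ((∑ i ∈ range (n / 4 + 1), (79 / 80 : ℝ) ^ i *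
            (2 * C * Real.exp (-(c * (P.length - i : ℕ))) / (P.length - i : ℕ))) *
          ∑ j ∈ range (n / 4 + 1), (79 / 80 : ℝ) ^ j *
            (2 * C * Real.exp (-(c * (Q.length - j : ℕ))) / (Q.length - j : ℕ))) ≤
          C * x / n := by
        calc _ ≤ √(n + 4) * ((1280 * (2 * C) * Real.exp (-(c * P.length)) / n) *
              (1280 * (2 * C) * Real.exp (-(c * Q.length)) / n)) := by
              refine mul_le_mul_of_nonneg_left (mul_le_mul hA hB ?_ ?_) (Real.sqrt_nonneg _)
              · exact sum_nonneg fun i _ => by positivity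
              · positivity
          _ = (√(n + 4) * (2 * 1280 ^ 2 * (2 * C))) * (C * x / n ^ 2) := by
              rw [← hexp]; field_simp
          _ ≤ n * (C * x / n ^ 2) := mul_le_mul_of_nonneg_right hsqrt (by positivity)
          _ = C * x / n := by field_simp
      have h2 : 2 * ((n + 4) * (79 / 80 : ℝ) ^ (4 * (n / 4 + 1))) ≤ C * x / n := by
        have h3 : (79 / 80 : ℝ) ^ (4 * (n / 4 + 1)) ≤ (79 / 80) ^ n :=
          pow_le_pow_of_le_one (by norm_num) (by norm_num) (by omega)
        have h4 : (79 / 80 : ℝ) ^ n ≤ (159 / 160) ^ n * x := by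
          have h5 : Real.exp c ^ n * x = 1 := by
            rw [hx, ← Real.exp_nat_mul, ← Real.exp_add, ← Real.exp_zero]; congr 1; ring
          calc (79 / 80 : ℝ) ^ n = (Real.exp c * (79 / 80)) ^ n * x := by
                rw [mul_pow, mul_right_comm, h5, one_mul]
            _ ≤ (159 / 160) ^ n * x := by gcongr
        rw [le_div_iff₀ hn0]
        calc 2 * ((n + 4) * (79 / 80 : ℝ) ^ (4 * (n / 4 + 1))) * n
            ≤ 2 * ((n + 4) * ((159 / 160) ^ n * x)) * n := by gcongr; exact h3.trans h4
          _ = (4 * n * (n + 4) * (159 / 160) ^ n) * x / 2 := by ring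
          _ ≤ 2 * C * x / 2 := by gcongr
          _ = C * x := by ring
      calc _ ≤ C * x / n + C * x / n := add_le_add h1 h2
        _ = _ := by ring

end

/-! ### From random graphs to random symmetric matrices -/

section

instance (n : ℕ) : MeasurableSingletonClass (SimpleGraph (Fin n)) where
  measurableSet_singleton G := by
    rw [← SimpleGraph.measurableEmbedding_edgeSet.measurableSet_image, Set.image_singleton]
    exact measurableSet_singleton _

lemma binomialRandom_half_singleton (n : ℕ) (H : SimpleGraph (Fin n)) :
    (SimpleGraph.binomialRandom (Fin n) edgeProbHalf).real {H} = (1 / 2) ^ n.choose 2 := by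
  classical
  have hle : H.edgeSet.ncard ≤ n.choose 2 := by
    have := H.card_edgeFinset_le_card_choose_two
    rwa [Fintype.card_fin, ← Set.ncard_coe_finset, SimpleGraph.coe_edgeFinset] at this
  rw [MeasureTheory.Measure.real, SimpleGraph.binomialRandom_singleton, Nat.card_fin,
    ENNReal.toReal_mul, ENNReal.toReal_pow, ENNReal.toReal_pow]
  have e1 : ((unitInterval.toNNReal edgeProbHalf : NNReal) : ℝ) = 1 / 2 := rfl
  have e2 : ((unitInterval.toNNReal (unitInterval.symm edgeProbHalf) : NNReal) : ℝ) = 1 / 2 := by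
    change (1 : ℝ) - 1 / 2 = 1 / 2
    norm_num
  rw [ENNReal.coe_toReal, ENNReal.coe_toReal, e1, e2, ← pow_add, Nat.add_sub_cancel' hle]

open Classical in
lemma probNotEvenDegenerate_eq (n : ℕ) : probNotEvenDegenerate n =
    ((univ.filter fun H : SimpleGraph (Fin n) => ¬ H.IsEvenDegenerate).card : ℝ) *
      (1 / 2) ^ n.choose 2 := by
  unfold probNotEvenDegenerate
  have h2 : {H : SimpleGraph (Fin n) | ¬ H.IsEvenDegenerate} =
      ((univ.filter fun H : SimpleGraph (Fin n) => ¬ H.IsEvenDegenerate :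
        Finset (SimpleGraph (Fin n))) : Set (SimpleGraph (Fin n))) := by
    ext; simp
  rw [h2, ← MeasureTheory.sum_measureReal_singleton, sum_congr rfl fun H _ => binomialRandom_half_singleton n H, sum_const,
    nsmul_eq_mul]

lemma isEvenDegenerate_of_list {n : ℕ} {G : SimpleGraph (Fin n)} {l : List (Fin n)}
    (hnd : l.Nodup) (hall : ∀ v, v ∈ l)
    (hl : ∀ a l', (a :: l') <:+ l → 2 ≤ l'.length → Even {w | w ∈ l' ∧ G.Adj a w}.ncard) :
    G.IsEvenDegenerate := by
  have hlen : l.length = n := by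
    rw [← List.toFinset_card_of_nodup hnd, eq_univ_of_forall fun v => List.mem_toFinset.2 (hall v),
      card_univ, Fintype.card_fin]
  have hn : Nat.card (Fin n) = l.length := by rw [hlen, Nat.card_fin]
  refine ⟨(finCongr hn).trans (hnd.getEquivOfForallMemList l hall), fun i hi => ?_⟩
  have hil : (i : ℕ) < l.length := by omega
  have hsuf : (l[(i : ℕ)] :: l.drop (i + 1)) <:+ l := by
    rw [← List.drop_eq_getElem_cons hil]; exact List.drop_suffix _ _
  have := hl _ _ hsuf (by rw [List.length_drop]; omega)
  convert this using 2
  ext w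
  simp only [Set.mem_inter_iff, SimpleGraph.mem_neighborSet, Set.mem_image, Set.mem_Ioi,
    Set.mem_ofPred_eq, and_comm (a := w ∈ _)]
  refine and_congr Iff.rfl ?_
  rw [List.mem_drop_iff_getElem]
  constructor
  · rintro ⟨j, hj, rfl⟩
    have hjl : (j : ℕ) < l.length := by have := j.2; omega
    have hij : (i : ℕ) < j := hj
    refine ⟨j - (i + 1), by omega, ?_⟩
    change l[_] = l[(j : ℕ)]
    congr 1; omega
  · rintro ⟨j, hj, rfl⟩
    refine ⟨⟨i + 1 + j, by omega⟩, ?_, rfl⟩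
    rw [Fin.lt_def]
    change (i : ℕ) < i + 1 + j
    omega

open Classical in
/-- The matrix of a graph with a distinguished last vertex: off the diagonal it is the adjacency
matrix of the remaining graph, on the diagonal it records adjacency to the last vertex. -/
noncomputable def pointedMatrix {m : ℕ} (G : SimpleGraph (Fin (m + 1))) : Sym2 (Fin m) → ZMod 2 :=
  Sym2.lift ⟨fun v w => if v = w then (if G.Adj v.castSucc (Fin.last m) then 1 else 0)
    else if G.Adj v.castSucc w.castSucc then 1 else 0, fun v w => by
      by_cases h : v = w
      · subst h; rfl
      · simp only [if_neg h, if_neg (Ne.symm h), G.adj_comm]⟩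

open Classical in
lemma pointedMatrix_self {m : ℕ} (G : SimpleGraph (Fin (m + 1))) (v : Fin m) :
    pointedMatrix G s(v, v) = if G.Adj v.castSucc (Fin.last m) then 1 else 0 := by
  simp [pointedMatrix]

open Classical in
lemma pointedMatrix_of_ne {m : ℕ} (G : SimpleGraph (Fin (m + 1))) {v w : Fin m} (h : v ≠ w) :
    pointedMatrix G s(v, w) = if G.Adj v.castSucc w.castSucc then 1 else 0 := by
  simp [pointedMatrix, h]

lemma pointedMatrix_injective {m : ℕ} :
    Function.Injective (pointedMatrix : SimpleGraph (Fin (m + 1)) → _) := by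
  classical
  intro G H h
  have key : ∀ p q : Prop, [Decidable p] → [Decidable q] →
      (if p then (1 : ZMod 2) else 0) = (if q then 1 else 0) → (p ↔ q) := by
    intro p q _ _ e
    by_cases hp : p <;> by_cases hq : q <;> simp_all
  have hl : ∀ v : Fin m, G.Adj v.castSucc (Fin.last m) ↔ H.Adj v.castSucc (Fin.last m) := by
    intro v
    have := congrFun h s(v, v)
    rw [pointedMatrix_self, pointedMatrix_self] at this
    exact key _ _ this
  ext a b
  induction a using Fin.lastCases with
  | last =>
    induction b using Fin.lastCases with
    | last => simp
    | cast b => rw [G.adj_comm, H.adj_comm]; exact hl b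
  | cast a =>
    induction b using Fin.lastCases with
    | last => exact hl a
    | cast b =>
      rcases eq_or_ne a b with rfl | hab
      · simp
      · have := congrFun h s(a, b)
        rw [pointedMatrix_of_ne G hab, pointedMatrix_of_ne H hab] at this
        exact key _ _ this

lemma parDeg_pointedMatrix {m : ℕ} (G : SimpleGraph (Fin (m + 1))) {S : Finset (Fin m)}
    {v : Fin m} (hv : v ∈ S) : parDeg (pointedMatrix G) S v =
      ({w | w ∈ insert (Fin.last m) ((S.erase v).map Fin.castSuccEmb) ∧
        G.Adj v.castSucc w}.ncard : ZMod 2) := by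
  classical
  have h1 : {w | w ∈ insert (Fin.last m) ((S.erase v).map Fin.castSuccEmb) ∧
      G.Adj v.castSucc w} = ((insert (Fin.last m) ((S.erase v).map Fin.castSuccEmb)).filter
        fun w => G.Adj v.castSucc w : Finset _) := by
    ext; simp only [coe_filter]
  rw [h1, Set.ncard_coe_finset, natCast_card_filter, sum_insert (by simp [Fin.castSucc_ne_last]),
    sum_map, parDeg, ← add_sum_erase S _ hv, pointedMatrix_self]
  congr 1
  refine sum_congr rfl fun w hw => ?_
  rw [pointedMatrix_of_ne G (ne_of_mem_erase hw).symm]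
  rfl

/-- The distinguished vertex is never deleted, so at most two vertices remain at the end, and these
are exempt from the parity condition. -/
lemma Reach.exists_list {m : ℕ} {G : SimpleGraph (Fin (m + 1))} {S S' : Finset (Fin m)}
    (h : Reach (pointedMatrix G) S S') (hS' : S'.card ≤ 1) :
    ∃ l : List (Fin (m + 1)), l.Nodup ∧ l.toFinset = insert (Fin.last m) (S.map Fin.castSuccEmb) ∧
      ∀ a l', (a :: l') <:+ l → 2 ≤ l'.length → Even {w | w ∈ l' ∧ G.Adj a w}.ncard := by
  induction h with
  | refl S =>
    have hlast : Fin.last m ∉ S.map Fin.castSuccEmb := by simp [Fin.castSucc_ne_last]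
    refine ⟨(insert (Fin.last m) (S.map Fin.castSuccEmb)).toList, nodup_toList _,
      toList_toFinset _, fun a l' hsuf h2 => ?_⟩
    have := hsuf.length_le
    rw [length_toList, card_insert_of_notMem hlast, card_map, List.length_cons] at this
    omega
  | @step S S' v hv hd _ ih =>
    obtain ⟨l, hnd, hl, hev⟩ := ih hS'
    have hvl : v.castSucc ∉ l := by
      rw [← List.mem_toFinset, hl]; simp [Fin.castSucc_ne_last]
    refine ⟨v.castSucc :: l, List.nodup_cons.2 ⟨hvl, hnd⟩, ?_, fun a l' hsuf h2 => ?_⟩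
    · rw [List.toFinset_cons, hl, Finset.insert_comm]
      conv_rhs => rw [← insert_erase hv, map_insert]
      rfl
    · rcases List.suffix_cons_iff.1 hsuf with h | h
      · obtain ⟨rfl, rfl⟩ := List.cons.inj h
        rw [parDeg_pointedMatrix G hv, ← hl, ZMod.natCast_eq_zero_iff_even] at hd
        simpa only [List.mem_toFinset] using hd
      · exact hev a l' h h2

lemma fail_pointedMatrix {m : ℕ} {G : SimpleGraph (Fin (m + 1))} (hG : ¬ G.IsEvenDegenerate) :
    Fail (pointedMatrix G) univ := by
  intro S' hS' hR
  obtain ⟨l, hnd, hl, hev⟩ := hR.exists_list hS'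
  refine hG (isEvenDegenerate_of_list hnd (fun v => ?_) hev)
  rw [← List.mem_toFinset, hl]
  induction v using Fin.lastCases <;> simp

/-- `Sym2 (Fin m)`, diagonal included, has as many elements as there are pairs of `m + 1` vertices,
so both probability spaces have the same size and injectivity of `pointedMatrix` is enough. -/
lemma probNotEvenDegenerate_succ_mul_le (m : ℕ) :
    probNotEvenDegenerate (m + 1) * Fintype.card (Sym2 (Fin m) → ZMod 2) ≤
      failCount (univ : Finset (Fin m)) := by
  classical
  have hcard : (Fintype.card (Sym2 (Fin m) → ZMod 2) : ℝ) = 2 ^ (m + 1).choose 2 := by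
    rw [Fintype.card_fun, Sym2.card, Fintype.card_fin, ZMod.card]; norm_cast
  rw [probNotEvenDegenerate_eq, hcard, mul_assoc, ← mul_pow, one_div, inv_mul_cancel₀ two_ne_zero,
    one_pow, mul_one, failCount]
  refine Nat.cast_le.2 (card_le_card_of_injOn pointedMatrix (fun G hG => ?_)
    pointedMatrix_injective.injOn)
  simp only [coe_filter, mem_univ, true_and, Set.mem_ofPred_eq] at hG ⊢
  exact fail_pointedMatrix hG

end

/-! ### The lower bound and the final constants -/

section

/-- The first vertex of an ordering needs even degree, so it is an isolated `y`. Its removal changes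
no degree, and the second vertex, still constrained as there are at least four vertices, is stuck.
-/
lemma not_isEvenDegenerate_of_odd {V : Type*} [Finite V] {G : SimpleGraph V} (y : V)
    (h4 : 4 ≤ Nat.card V) (hodd : ∀ v, v ≠ y → Odd (G.neighborSet v).ncard)
    (hy : Odd (G.neighborSet y).ncard ∨ G.neighborSet y = ∅) : ¬ G.IsEvenDegenerate := by
  rintro ⟨v, hv⟩
  let i₀ : Fin (Nat.card V) := ⟨0, by omega⟩
  let i₁ : Fin (Nat.card V) := ⟨1, by omega⟩
  have h0 : G.neighborSet (v i₀) ∩ v '' Set.Ioi i₀ = G.neighborSet (v i₀) := by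
    refine Set.inter_eq_left.2 fun w hw => ?_
    obtain ⟨j, rfl⟩ := v.surjective w
    refine ⟨j, ?_, rfl⟩
    have hj : j ≠ i₀ := by rintro rfl; exact G.irrefl hw
    have : (j : ℕ) ≠ 0 := fun e => hj (Fin.ext e)
    exact Fin.lt_def.2 (Nat.pos_of_ne_zero this)
  have e0 := hv i₀ (by change 0 + 2 < _; omega)
  rw [h0] at e0
  have hy0 : v i₀ = y := by
    by_contra hne
    exact Nat.not_even_iff_odd.2 (hodd _ hne) e0
  rw [hy0] at e0
  have hempty : G.neighborSet y = ∅ := hy.resolve_left fun h => Nat.not_even_iff_odd.2 h e0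
  have h1 : G.neighborSet (v i₁) ∩ v '' Set.Ioi i₁ = G.neighborSet (v i₁) := by
    refine Set.inter_eq_left.2 fun w hw => ?_
    obtain ⟨j, rfl⟩ := v.surjective w
    refine ⟨j, ?_, rfl⟩
    have hj : (j : ℕ) ≠ 1 := by
      intro e
      obtain rfl : j = i₁ := Fin.ext e
      exact G.irrefl hw
    have hj0 : (j : ℕ) ≠ 0 := by
      intro e
      obtain rfl : j = i₀ := Fin.ext e
      rw [hy0] at hw
      have : v i₁ ∈ G.neighborSet y := G.adj_symm hw
      rw [hempty] at this
      exact this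
    refine Fin.lt_def.2 ?_
    change 1 < (j : ℕ)
    omega
  have e1 := hv i₁ (by change 1 + 2 < _; omega)
  rw [h1] at e1
  refine Nat.not_even_iff_odd.2 (hodd _ fun h => ?_) e1
  have := v.injective (h.trans hy0.symm)
  exact absurd (congrArg Fin.val this) one_ne_zero

/-- The graph obtained from `G` by adding a new last vertex adjacent to the vertices in `A`. -/
def addLast {m : ℕ} (G : SimpleGraph (Fin m)) (A : Set (Fin m)) : SimpleGraph (Fin (m + 1)) where
  Adj a b := (∃ v w, a = v.castSucc ∧ b = w.castSucc ∧ G.Adj v w) ∨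
    (∃ v ∈ A, a = v.castSucc ∧ b = Fin.last m) ∨ (∃ v ∈ A, b = v.castSucc ∧ a = Fin.last m)
  symm := ⟨by
    rintro a b (⟨v, w, h1, h2, h3⟩ | h | h)
    · exact .inl ⟨w, v, h2, h1, h3.symm⟩
    · exact .inr (.inr h)
    · exact .inr (.inl h)⟩
  loopless := ⟨by
    rintro a (⟨v, w, h1, h2, h3⟩ | ⟨v, -, h1, h2⟩ | ⟨v, -, h1, h2⟩)
    · rw [h1] at h2
      rw [Fin.castSucc_injective m h2] at h3
      exact G.irrefl h3
    · exact Fin.castSucc_ne_last v (h1.symm.trans h2)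
    · exact Fin.castSucc_ne_last v (h1.symm.trans h2)⟩

section addLast

variable {m : ℕ} (G : SimpleGraph (Fin m)) (A : Set (Fin m))

lemma addLast_adj_castSucc (v w : Fin m) :
    (addLast G A).Adj v.castSucc w.castSucc ↔ G.Adj v w := by
  simp [addLast, Fin.castSucc_ne_last]

lemma addLast_adj_last (v : Fin m) : (addLast G A).Adj v.castSucc (Fin.last m) ↔ v ∈ A := by
  simp [addLast, Fin.castSucc_ne_last, (Fin.castSucc_ne_last _).symm]

lemma neighborSet_addLast_last :
    (addLast G A).neighborSet (Fin.last m) = Fin.castSucc '' A := by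
  ext w
  rw [SimpleGraph.mem_neighborSet, SimpleGraph.adj_comm]
  induction w using Fin.lastCases with
  | last => simp [Fin.castSucc_ne_last]
  | cast w => simp [addLast_adj_last]

lemma ncard_neighborSet_addLast_last :
    ((addLast G A).neighborSet (Fin.last m)).ncard = A.ncard := by
  rw [neighborSet_addLast_last, Set.ncard_image_of_injective _ (Fin.castSucc_injective m)]

lemma ncard_neighborSet_addLast_of_mem {v : Fin m} (hv : v ∈ A) :
    ((addLast G A).neighborSet v.castSucc).ncard = (G.neighborSet v).ncard + 1 := by
  have : (addLast G A).neighborSet v.castSucc =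
      insert (Fin.last m) (Fin.castSucc '' G.neighborSet v) := by
    ext w
    rw [SimpleGraph.mem_neighborSet]
    induction w using Fin.lastCases with
    | last => simp [addLast_adj_last, hv]
    | cast w => simp [addLast_adj_castSucc, Fin.castSucc_ne_last]
  rw [this, Set.ncard_insert_of_notMem (by simp [Fin.castSucc_ne_last]),
    Set.ncard_image_of_injective _ (Fin.castSucc_injective m)]

lemma ncard_neighborSet_addLast_of_notMem {v : Fin m} (hv : v ∉ A) :
    ((addLast G A).neighborSet v.castSucc).ncard = (G.neighborSet v).ncard := by
  have : (addLast G A).neighborSet v.castSucc = Fin.castSucc '' G.neighborSet v := by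
    ext w
    rw [SimpleGraph.mem_neighborSet]
    induction w using Fin.lastCases with
    | last => simp [addLast_adj_last, hv, Fin.castSucc_ne_last]
    | cast w => simp [addLast_adj_castSucc]
  rw [this, Set.ncard_image_of_injective _ (Fin.castSucc_injective m)]

end addLast

/-- The set of vertices of even degree. -/
def evenSet {k : ℕ} (G : SimpleGraph (Fin k)) : Set (Fin k) := {v | Even (G.neighborSet v).ncard}

/-- Handshake lemma: the number of vertices of odd degree is even. -/
lemma even_ncard_evenSet_iff {k : ℕ} (G : SimpleGraph (Fin k)) :
    Even (evenSet G).ncard ↔ Even k := by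
  classical
  have h1 := G.even_card_odd_degree_vertices
  have hdeg : ∀ v, G.degree v = (G.neighborSet v).ncard := fun v => by
    rw [← SimpleGraph.card_neighborSet_eq_degree, ← Nat.card_eq_fintype_card, Nat.card_coe_set_eq]
  have h2 : (univ.filter fun v => Odd (G.degree v)).card = (evenSet G)ᶜ.ncard := by
    rw [← Set.ncard_coe_finset]
    congr 1
    ext v
    simp [evenSet, hdeg]
  rw [h2] at h1
  have h3 := Set.ncard_add_ncard_compl (evenSet G)
  rw [Nat.card_fin] at h3
  have h4 := Nat.even_add (m := (evenSet G).ncard) (n := (evenSet G)ᶜ.ncard)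
  rw [h3] at h4
  rw [h4, iff_true_right h1]

/-- Every graph on `k` vertices extends to a graph on `k + 2` vertices which has no, or only one,
vertex of even degree, and this vertex is isolated. -/
def oddExtension {k : ℕ} (G : SimpleGraph (Fin k)) : SimpleGraph (Fin (k + 2)) :=
  addLast (addLast G (evenSet G)) {v | v = Fin.last k ∧ Even k}

lemma oddExtension_injective (k : ℕ) :
    Function.Injective (oddExtension : SimpleGraph (Fin k) → SimpleGraph (Fin (k + 2))) := by
  intro G H h
  ext v w
  have h1 : (oddExtension G).Adj v.castSucc.castSucc w.castSucc.castSucc ↔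
      (oddExtension H).Adj v.castSucc.castSucc w.castSucc.castSucc := by rw [h]
  simpa only [oddExtension, addLast_adj_castSucc] using h1

/-- Joining the first new vertex to `evenSet G` makes all old degrees odd, and its own degree has
the parity of `k`. For even `k` an edge to the second new vertex repairs it; for odd `k` the second
new vertex stays isolated. -/
lemma not_isEvenDegenerate_oddExtension {k : ℕ} (hk : 2 ≤ k) (G : SimpleGraph (Fin k)) :
    ¬ (oddExtension G).IsEvenDegenerate := by
  refine not_isEvenDegenerate_of_odd (Fin.last (k + 1)) (by rw [Nat.card_fin]; omega) ?_ ?_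
  · intro v hv
    induction v using Fin.lastCases with
    | last => exact absurd rfl hv
    | cast v =>
      induction v using Fin.lastCases with
      | last =>
        by_cases hk : Even k
        · rw [oddExtension, ncard_neighborSet_addLast_of_mem _ _
              (show Fin.last k ∈ {v | v = Fin.last k ∧ Even k} from ⟨rfl, hk⟩),
            ncard_neighborSet_addLast_last]
          exact ((even_ncard_evenSet_iff G).2 hk).add_one
        · rw [oddExtension, ncard_neighborSet_addLast_of_notMem _ _ fun h => hk h.2,
            ncard_neighborSet_addLast_last, ← Nat.not_even_iff_odd, even_ncard_evenSet_iff]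
          exact hk
      | cast v =>
        rw [oddExtension,
          ncard_neighborSet_addLast_of_notMem _ _ fun h => Fin.castSucc_ne_last v h.1]
        by_cases hv : v ∈ evenSet G
        · rw [ncard_neighborSet_addLast_of_mem _ _ hv]
          exact Even.add_one hv
        · rw [ncard_neighborSet_addLast_of_notMem _ _ hv]
          exact Nat.not_even_iff_odd.1 hv
  · by_cases hk : Even k
    · left
      have : {v | v = Fin.last k ∧ Even k} = {Fin.last k} := by ext; simp [hk]
      rw [oddExtension, ncard_neighborSet_addLast_last, this, Set.ncard_singleton]
      exact odd_one
    · right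
      have : {v | v = Fin.last k ∧ Even k} = ∅ := by ext; simp [hk]
      rw [oddExtension, neighborSet_addLast_last, this, Set.image_empty]

lemma card_simpleGraph_mul_half_pow (n : ℕ) :
    (Fintype.card (SimpleGraph (Fin n)) : ℝ) * (1 / 2) ^ n.choose 2 = 1 := by
  have := MeasureTheory.probReal_univ (μ := SimpleGraph.binomialRandom (Fin n) edgeProbHalf)
  rw [← Finset.coe_univ, ← MeasureTheory.sum_measureReal_singleton,
    sum_congr rfl fun H _ => binomialRandom_half_singleton n H, sum_const, nsmul_eq_mul,
    card_univ] at this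
  exact this

lemma half_pow_le_probNotEvenDegenerate {n : ℕ} (hn : 4 ≤ n) :
    (1 / 2 : ℝ) ^ (2 * n - 3) ≤ probNotEvenDegenerate n := by
  classical
  obtain ⟨k, rfl⟩ := Nat.exists_eq_add_of_le' (by omega : 2 ≤ n)
  have hchoose : (k + 2).choose 2 = k.choose 2 + (2 * (k + 2) - 3) := by
    have h1 : (k + 2).choose 2 = (k + 1).choose 1 + (k + 1).choose 2 := Nat.choose_succ_succ' _ _
    have h2 : (k + 1).choose 2 = k.choose 1 + k.choose 2 := Nat.choose_succ_succ' _ _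
    rw [Nat.choose_one_right] at h1 h2
    omega
  have hle : (Fintype.card (SimpleGraph (Fin k)) : ℝ) ≤
      ((univ.filter fun H : SimpleGraph (Fin (k + 2)) => ¬ H.IsEvenDegenerate).card : ℝ) := by
    rw [← card_univ]
    refine Nat.cast_le.2 (card_le_card_of_injOn oddExtension (fun G _ => ?_)
      (oddExtension_injective k).injOn)
    simpa using not_isEvenDegenerate_oddExtension (by omega) G
  rw [probNotEvenDegenerate_eq, hchoose, pow_add, ← mul_assoc]
  refine le_mul_of_one_le_left (by positivity) ?_
  refine (card_simpleGraph_mul_half_pow k).symm.trans_le ?_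
  exact mul_le_mul_of_nonneg_right hle (pow_nonneg one_half_pos.le _)

/-- The empty graph is even-degenerate. Strictness lets a small enough `c` handle each of the
finitely many `n` below the asymptotic range. -/
lemma probNotEvenDegenerate_lt_one (n : ℕ) : probNotEvenDegenerate n < 1 := by
  classical
  rw [probNotEvenDegenerate_eq]
  refine lt_of_lt_of_eq ?_ (card_simpleGraph_mul_half_pow n)
  refine mul_lt_mul_of_pos_right ?_ (pow_pos one_half_pos _)
  rw [← card_univ]
  refine Nat.cast_lt.2 (card_lt_card ⟨filter_subset _ _, fun h => ?_⟩)
  refine (mem_filter.1 (h (mem_univ ⊥))).2 ⟨(Finite.equivFin (Fin n)).symm, fun i _ => ?_⟩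
  have : (⊥ : SimpleGraph (Fin n)).neighborSet ((Finite.equivFin (Fin n)).symm i) = ∅ := by
    ext; simp
  rw [this]
  simp

lemma exists_probNotEvenDegenerate_le_exp_eventually : ∃ c : ℝ, 0 < c ∧
    ∃ n₀, ∀ n ≥ n₀, probNotEvenDegenerate n ≤ Real.exp (-(c * n)) := by
  obtain ⟨c, D, hc, hD, h⟩ := exists_failCount_le_exp
  refine ⟨c / 2, by positivity, ?_⟩
  obtain ⟨n₁, hn₁⟩ := Filter.eventually_atTop.1
    ((tendsto_natCast_atTop_atTop (R := ℝ)).eventually_ge_atTop (D * Real.exp c))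
  refine ⟨n₁ + 2, fun n hn => ?_⟩
  obtain ⟨m, rfl⟩ := Nat.exists_eq_add_of_le' (by omega : 1 ≤ n)
  have hm : 1 ≤ m := by omega
  have hm0 : (0 : ℝ) < m := by exact_mod_cast hm
  have h1 := h (Fin m) univ (by rwa [card_univ, Fintype.card_fin])
  rw [card_univ, Fintype.card_fin] at h1
  have h2 : probNotEvenDegenerate (m + 1) ≤ D * Real.exp (-(c * m)) / m :=
    le_of_mul_le_mul_right ((probNotEvenDegenerate_succ_mul_le m).trans h1)
      (by exact_mod_cast Fintype.card_pos)
  refine h2.trans ?_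
  have h3 : Real.exp (-(c * m)) = Real.exp c * Real.exp (-(c * (m + 1 : ℕ))) := by
    rw [← Real.exp_add]; congr 1; push_cast; ring
  rw [div_le_iff₀ hm0, h3, ← mul_assoc, mul_comm]
  refine mul_le_mul (Real.exp_le_exp.2 ?_) (hn₁ m (by omega)) (by positivity) (by positivity)
  have : 0 ≤ c * (m + 1 : ℕ) := by positivity
  linarith

lemma exists_probNotEvenDegenerate_le_exp : ∃ c : ℝ, 0 < c ∧
    ∀ n, 1 ≤ n → probNotEvenDegenerate n ≤ Real.exp (-(c * n)) := by
  obtain ⟨c₀, hc₀, n₀, h⟩ := exists_probNotEvenDegenerate_le_exp_eventually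
  have hsmall : ∀ N : ℕ, ∃ c : ℝ, 0 < c ∧ ∀ n, 1 ≤ n → n < N →
      probNotEvenDegenerate n ≤ Real.exp (-(c * n)) := by
    intro N
    induction N with
    | zero => exact ⟨1, one_pos, fun n _ hn => absurd hn (by omega)⟩
    | succ N ih =>
      obtain ⟨c, hc, ih⟩ := ih
      have hlim : Filter.Tendsto (fun x : ℝ => Real.exp (-(x * N))) (nhdsWithin 0 (Set.Ioi 0))
          (nhds (Real.exp (-(0 * N)))) := by
        refine Filter.Tendsto.mono_left ?_ nhdsWithin_le_nhds
        exact (by fun_prop : Continuous fun x : ℝ => Real.exp (-(x * N))).tendsto 0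
      rw [zero_mul, neg_zero, Real.exp_zero] at hlim
      obtain ⟨c', hc', hc'0⟩ := ((hlim.eventually_const_le
        (probNotEvenDegenerate_lt_one N)).and self_mem_nhdsWithin).exists
      refine ⟨min c c', lt_min hc hc'0, fun n hn1 hnN => ?_⟩
      rcases Nat.lt_succ_iff_lt_or_eq.1 hnN with hlt | rfl
      · refine (ih n hn1 hlt).trans (Real.exp_le_exp.2 (neg_le_neg ?_))
        exact mul_le_mul_of_nonneg_right (min_le_left _ _) (Nat.cast_nonneg _)
      · refine hc'.trans (Real.exp_le_exp.2 (neg_le_neg ?_))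
        exact mul_le_mul_of_nonneg_right (min_le_right _ _) (Nat.cast_nonneg _)
  obtain ⟨c₁, hc₁, h'⟩ := hsmall n₀
  refine ⟨min c₀ c₁, lt_min hc₀ hc₁, fun n hn => ?_⟩
  rcases Nat.lt_or_ge n n₀ with hlt | hge
  · refine (h' n hn hlt).trans (Real.exp_le_exp.2 (neg_le_neg ?_))
    exact mul_le_mul_of_nonneg_right (min_le_right _ _) (Nat.cast_nonneg _)
  · refine (h n hge).trans (Real.exp_le_exp.2 (neg_le_neg ?_))
    exact mul_le_mul_of_nonneg_right (min_le_left _ _) (Nat.cast_nonneg _)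

end

end ParityPeeling

open ParityPeeling in
theorem mainTheorem4 :
    (∀ n : ℕ, 4 ≤ n → (1 / 2 : ℝ) ^ (2 * n - 3) ≤ probNotEvenDegenerate n) ∧
    ∃ c C : ℝ, 0 < c ∧ 0 < C ∧ ∀ n : ℕ, 4 ≤ n →
      Real.exp (-(C * n)) ≤ probNotEvenDegenerate n ∧
      probNotEvenDegenerate n ≤ Real.exp (-(c * n)) := by
  obtain ⟨c, hc, h⟩ := exists_probNotEvenDegenerate_le_exp
  refine ⟨fun n hn => half_pow_le_probNotEvenDegenerate hn, c, 2 * Real.log 2, hc,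
    mul_pos two_pos (Real.log_pos one_lt_two), fun n hn => ⟨?_, h n (by omega)⟩⟩
  refine le_trans ?_ (half_pow_le_probNotEvenDegenerate hn)
  have h1 : Real.exp (-(2 * Real.log 2 * n)) = (1 / 2) ^ (2 * n) := by
    rw [one_div, ← Real.exp_log (by norm_num : (0 : ℝ) < 2⁻¹), ← Real.exp_nat_mul, Real.log_inv]
    congr 1; push_cast; ring
  rw [h1]
  exact pow_le_pow_of_le_one (by norm_num) (by norm_num) (Nat.sub_le _ _)
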